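/- Let $d\ge 1$. For $m\in\mathbb R^d$ and a measurable $\rho:[0,\infty)\to[0,\infty)$, write $\mu=R_d(m,\rho)$ if $\mu$ is a probability measure on $\mathbb R^d$ with finite second moment and density $x\mapsto\rho(|x-m|)$. For measures $\mu,\nu$ of equal total mass let $W_2(\mu,\nu)^2=\inf_\gamma\int|x-y|^2\,d\gamma(x,y)$, the infimum being over all measures $\gamma$ with marginals $\mu$ and $\nu$. A Monge map transporting $\mu$ to $\nu$ is a minimizer of $\int|x-T(x)|^2\,d\mu(x)$ among the measurable maps $T$ with $T_\#\mu=\nu$. If $T$ is the Monge map, unique up to $\mu$-null sets, the McCann interpolation is $\mu_t=(T_t)_\#\mu$ with $T_t(x)=(1-t)x+tT(x)$, $0\le t\le 1$. For $\rho:[0,\infty)\to[0,\infty)$ let $\rho^{\rm rad}$ be the measure $r^{d-1}\rho(r)\,dr$ on $[0,\infty)$, and let $|\mathbb S^{d-1}|=2\pi^{d/2}/\Gamma(d/2)$. **Theorem.** Let $\mu_0=R_d(m_0,\rho_0)$ and $\mu_1=R_d(m_1,\rho_1)$ with continuous $\rho_0,\rho_1$. There is a nondecreasing function $C:[0,\infty)\to[0,\infty]$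 with $$\int_0^R r^{d-1}\rho_0(r)\,dr=\int_0^{C(R)}r^{d-1}\rho_1(r)\,dr\qquad\text{for all }R\ge 0.\qquad(*)$$ Moreover, every measurable $C:[0,\infty)\to[0,\infty]$ with $(*)$ has the following properties. 1. For $\mu_0$-almost every $x$ one has $x\ne m_0$ and $C(|x-m_0|)<\infty$, and the Monge map transporting $\mu_0$ to $\mu_1$ is, uniquely up to $\mu_0$-null sets, $$T(x)=\frac{C(|x-m_0|)}{|x-m_0|}(x-m_0)+m_1$$ (with the value $m_1$, say, on the null set where the formula has no meaning). 2. For every $t\in[0,1]$ put $m_t=(1-t)m_0+tm_1$ and $C_t(r)=(1-t)r+tC(r)$ (where $C(r)=\infty$, which happens only on a $\rho_0^{\rm rad}$-null set, $C(r)$ is read as $0$). There is a measurable $\rho_t:[0,\infty)\to[0,\infty)$ with $(C_t)_\#\rho_0^{\rm rad}=\rho_t^{\rm rad}$, and for every such $\rho_t$ the McCann interpolation satisfies $\mu_t=R_d(m_t,\rho_t)$. 3. The function $r\mapsto(C(r)-r)^2\rho_0(r)r^{d-1}$ is integrable on $[0,\infty)$, and $$W_2(\mu_0,\mu_1)^2=|m_0-m_1|^2+|\mathbb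 S^{d-1}|\,W_2(\rho_0^{\rm rad},\rho_1^{\rm rad})^2=|m_0-m_1|^2+|\mathbb S^{d-1}|\int_0^\infty (C(r)-r)^2\rho_0(r)\,r^{d-1}\,dr.$$ -/

import Mathlib

open MeasureTheory Set
open scoped NNReal ENNReal

noncomputable section

/-- `μ = R_d(m, ρ)`: the probability measure `μ` on `ℝ^d` has density `x ↦ ρ(|x - m|)`, where the
generator `ρ : [0, ∞) → [0, ∞)` is measurable, and `μ` has a finite second moment. -/
structure IsRadiallyContoured {d : ℕ} (μ : Measure (EuclideanSpace ℝ (Fin d)))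
    (m : EuclideanSpace ℝ (Fin d)) (ρ : ℝ≥0 → ℝ≥0) : Prop where
  measurable_generator : Measurable ρ
  isProbabilityMeasure : IsProbabilityMeasure μ
  eq_withDensity : μ = (volume : Measure (EuclideanSpace ℝ (Fin d))).withDensity
    (fun x => (ρ ‖x - m‖₊ : ℝ≥0∞))
  secondMoment_lt_top : ∫⁻ x, ‖x‖ₑ ^ 2 ∂μ < ∞

/-- Lebesgue measure `dr` on the half-line `[0, ∞)`. -/
def halfLineVolume : Measure ℝ≥0 :=
  (volume : Measure ℝ).comap ((↑) : ℝ≥0 → ℝ)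

/-- The measure `r^(d-1) ρ(r) dr` on the half-line `[0, ∞)`, written `R_1(0, r^(d-1) ρ(r))`. For a
generator `ρ` of a radially contoured distribution its total mass is `1 / |S^(d-1)|`. -/
def radialMeasure (d : ℕ) (ρ : ℝ≥0 → ℝ≥0) : Measure ℝ≥0 :=
  halfLineVolume.withDensity (fun r => ((r ^ (d - 1) * ρ r : ℝ≥0) : ℝ≥0∞))

/-- The surface area `|S^(d-1)| = 2 π^(d/2) / Γ(d/2)` of the unit sphere of `ℝ^d`. -/
def sphereArea (d : ℕ) : ℝ :=
  2 * Real.pi ^ ((d : ℝ) / 2) / Real.Gamma ((d : ℝ) / 2)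

/-- The measures on `X × X` with marginals `μ` and `ν`. -/
def couplings {X : Type*} [MeasurableSpace X] (μ ν : Measure X) : Set (Measure (X × X)) :=
  {γ | γ.map Prod.fst = μ ∧ γ.map Prod.snd = ν}

/-- The quadratic Wasserstein distance, for measures of equal total mass:
the square root of the infimum of `∫ |x - y|² dγ(x, y)` over all couplings `γ`. -/
def wassersteinTwo {X : Type*} [PseudoEMetricSpace X] [MeasurableSpace X] (μ ν : Measure X) :
    ℝ≥0∞ :=
  (⨅ γ ∈ couplings μ ν, ∫⁻ p, edist p.1 p.2 ^ 2 ∂γ) ^ (1 / 2 : ℝ)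

/-- `T` is a Monge map transporting `μ` to `ν`: a minimizer of `∫ |x - T(x)|² dμ(x)` among the
measurable maps that push `μ` forward to `ν`. -/
structure IsMongeMap {X : Type*} [PseudoEMetricSpace X] [MeasurableSpace X] (μ ν : Measure X)
    (T : X → X) : Prop where
  measurable : Measurable T
  map_eq : μ.map T = ν
  optimal : ∀ S : X → X, Measurable S → μ.map S = ν →
    ∫⁻ x, edist x (T x) ^ 2 ∂μ ≤ ∫⁻ x, edist x (S x) ^ 2 ∂μ

/-- The point `μ_t = (T_t)_# μ`, `T_t(x) = (1 - t) x + t T(x)`, of the McCann interpolation along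
the Monge map `T` that starts from `μ`. -/
def mccannInterpolation {d : ℕ} (μ : Measure (EuclideanSpace ℝ (Fin d)))
    (T : EuclideanSpace ℝ (Fin d) → EuclideanSpace ℝ (Fin d)) (t : ℝ) :
    Measure (EuclideanSpace ℝ (Fin d)) :=
  μ.map (fun x => (1 - t) • x + t • T x)

/-- The matching condition
`∫_0^R r^(d-1) ρ₀(r) dr = ∫_0^{C(R)} r^(d-1) ρ₁(r) dr` for all `R ≥ 0`,
for a function `C : [0, ∞) → [0, ∞]`. -/
def MatchesRadialMass (d : ℕ) (ρ₀ ρ₁ : ℝ≥0 → ℝ≥0) (C : ℝ≥0 → ℝ≥0∞) : Prop :=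
  ∀ R : ℝ≥0,
    ∫⁻ r in {r : ℝ≥0 | r ≤ R}, ((r ^ (d - 1) * ρ₀ r : ℝ≥0) : ℝ≥0∞) ∂halfLineVolume =
      ∫⁻ r in {r : ℝ≥0 | (r : ℝ≥0∞) ≤ C R}, ((r ^ (d - 1) * ρ₁ r : ℝ≥0) : ℝ≥0∞) ∂halfLineVolume

/-- The map `T(x) = C(|x - m₀|) (x - m₀) / |x - m₀| + m₁`. Where this formula has no meaning, namely
at `x = m₀` and where `C(|x - m₀|) = ∞`, the value is `m₁`. -/
def radialTransport {d : ℕ} (m₀ m₁ : EuclideanSpace ℝ (Fin d)) (C : ℝ≥0 → ℝ≥0∞)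
    (x : EuclideanSpace ℝ (Fin d)) : EuclideanSpace ℝ (Fin d) :=
  ((C ‖x - m₀‖₊).toReal / ‖x - m₀‖) • (x - m₀) + m₁

/-- The map `C_t(r) = (1 - t) r + t C(r)` on `[0, ∞)`, for `0 ≤ t ≤ 1` and `C(r) < ∞`. -/
def radialInterp (C : ℝ≥0 → ℝ≥0∞) (t : ℝ) (r : ℝ≥0) : ℝ≥0 :=
  Real.toNNReal ((1 - t) * (r : ℝ) + t * (C r).toReal)

end

/-! In polar coordinates about `m₀`, `μ₀` is the image of the product of the surface measure of the
unit sphere and ρ₀^rad, so the radius |x - m₀| has law |S^(d-1)| ρ₀^rad; likewise for `μ₁`. Take any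
coupling γ. Both x - m₀ and y - m₁ have mean zero by symmetry, so the cost of γ is |m₀ - m₁|² plus
the centred cost. By the reverse triangle inequality the centred cost is at least the cost of the
pair of radii, which couples the two radial laws on the half-line, where a monotone map is optimal.
T moves radii by C and keeps directions, so it attains equality at both stages
(`lintegral_edist_radialTransport_sq`). Conversely equality forces the coupling: uniqueness on the
half-line fixes |y - m₁|, and equality in the reverse triangle inequality fixes the direction
(`lintegral_edist_sq_coupling_ge`).

On the half-line, expanding the square turns least cost into greatest ∫ r s dγ, and this is the
integral over (u, v) of γ((u,∞) × (v,∞)). The graph of a monotone map gives each quadrant the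
smaller of its two marginal masses, the largest possible value, and quadrant masses together with
the marginals determine a coupling (`lintegral_edist_sq_le_of_monotoneOn`).

The condition (*) does not make C monotone, as C may vary freely across gaps of the radial laws. But
the distribution function of a finite atomless measure is strictly increasing at almost every point;
hence C is finite and monotone off a null set and pushes ρ₀^rad to ρ₁^rad. For t < 1 the map C_t
then expands distances by at least the factor 1 - t off a null set, so the image of ρ₀^rad stays
absolutely continuous. -/

/-! ### Lebesgue measure on the half-line -/

theorem measurableEmbedding_coe_nnreal_real : MeasurableEmbedding ((↑) : ℝ≥0 → ℝ) :=
  MeasurableEmbedding.subtype_coe measurableSet_Ici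

theorem map_coe_halfLineVolume :
    halfLineVolume.map ((↑) : ℝ≥0 → ℝ) = volume.restrict (Ici 0) := by
  rw [halfLineVolume, measurableEmbedding_coe_nnreal_real.map_comap]
  congr 1
  ext x
  exact ⟨fun ⟨y, hy⟩ => hy ▸ y.2, fun hx => ⟨⟨x, hx⟩, rfl⟩⟩

theorem halfLineVolume_apply (s : Set ℝ≥0) :
    halfLineVolume s = volume (((↑) : ℝ≥0 → ℝ) '' s) := by
  rw [halfLineVolume, measurableEmbedding_coe_nnreal_real.comap_apply]

theorem halfLineVolume_Iio (r : ℝ≥0) : halfLineVolume (Iio r) = r := by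
  have h : ((↑) : ℝ≥0 → ℝ) '' Iio r = Ico 0 (r : ℝ) := by
    ext x
    constructor
    · rintro ⟨y, hy, rfl⟩
      exact ⟨y.2, by exact_mod_cast hy⟩
    · rintro ⟨h0, h1⟩
      exact ⟨⟨x, h0⟩, by exact_mod_cast h1, rfl⟩
  rw [halfLineVolume_apply, h]
  simp

instance : NullSingletonClass halfLineVolume :=
  ⟨fun x => by rw [halfLineVolume_apply]; simp⟩

instance : SigmaFinite halfLineVolume := by
  have : SigmaFinite (halfLineVolume.map ((↑) : ℝ≥0 → ℝ)) := by
    rw [map_coe_halfLineVolume]; infer_instance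
  exact SigmaFinite.of_map _ measurable_subtype_coe.aemeasurable this

theorem halfLineVolume_Ioo_pos {a b : ℝ≥0} (h : a < b) : 0 < halfLineVolume (Ioo a b) := by
  have h' : ((↑) : ℝ≥0 → ℝ) '' Ioo a b = Ioo (a : ℝ) (b : ℝ) := by
    ext x
    constructor
    · rintro ⟨y, hy, rfl⟩
      exact ⟨by exact_mod_cast hy.1, by exact_mod_cast hy.2⟩
    · rintro ⟨h0, h1⟩
      exact ⟨⟨x, a.2.trans h0.le⟩, ⟨by exact_mod_cast h0, by exact_mod_cast h1⟩, rfl⟩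
  rw [halfLineVolume_apply, h']
  simpa using h

/-! ### Quadrant masses and monotone rearrangement on the half-line -/

/-- Layer-cake formula for the product of the two coordinates. -/
theorem lintegral_mul_eq_lintegral_measure_Ioi (γ : Measure (ℝ≥0 × ℝ≥0)) [SFinite γ] :
    ∫⁻ p, (p.1 : ℝ≥0∞) * p.2 ∂γ =
      ∫⁻ q, γ (Ioi q.1 ×ˢ Ioi q.2) ∂(halfLineVolume.prod halfLineVolume) := by
  have hset : MeasurableSet {z : (ℝ≥0 × ℝ≥0) × (ℝ≥0 × ℝ≥0) | z.2.1 < z.1.1 ∧ z.2.2 < z.1.2} :=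
    (measurableSet_lt (by fun_prop) (by fun_prop)).inter
      (measurableSet_lt (by fun_prop) (by fun_prop))
  calc ∫⁻ p, (p.1 : ℝ≥0∞) * p.2 ∂γ
      = ∫⁻ p, ∫⁻ q, {z : (ℝ≥0 × ℝ≥0) × (ℝ≥0 × ℝ≥0) | z.2.1 < z.1.1 ∧ z.2.2 < z.1.2}.indicator
          (1 : (ℝ≥0 × ℝ≥0) × (ℝ≥0 × ℝ≥0) → ℝ≥0∞) (p, q) ∂(halfLineVolume.prod halfLineVolume) ∂γ := by
        refine lintegral_congr fun p => ?_
        have : (fun q : ℝ≥0 × ℝ≥0 => {z : (ℝ≥0 × ℝ≥0) × (ℝ≥0 × ℝ≥0) |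
            z.2.1 < z.1.1 ∧ z.2.2 < z.1.2}.indicator
            (1 : (ℝ≥0 × ℝ≥0) × (ℝ≥0 × ℝ≥0) → ℝ≥0∞) (p, q)) =
            (Iio p.1 ×ˢ Iio p.2).indicator 1 := by
          ext q
          simp [indicator]
        rw [this, lintegral_indicator_one (measurableSet_Iio.prod measurableSet_Iio),
          Measure.prod_prod, halfLineVolume_Iio, halfLineVolume_Iio]
    _ = ∫⁻ q, ∫⁻ p, {z : (ℝ≥0 × ℝ≥0) × (ℝ≥0 × ℝ≥0) | z.2.1 < z.1.1 ∧ z.2.2 < z.1.2}.indicator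
          (1 : (ℝ≥0 × ℝ≥0) × (ℝ≥0 × ℝ≥0) → ℝ≥0∞) (p, q) ∂γ ∂(halfLineVolume.prod halfLineVolume) :=
        lintegral_lintegral_swap (measurable_one.indicator hset).aemeasurable
    _ = _ := by
        refine lintegral_congr fun q => ?_
        have : (fun p : ℝ≥0 × ℝ≥0 => {z : (ℝ≥0 × ℝ≥0) × (ℝ≥0 × ℝ≥0) |
            z.2.1 < z.1.1 ∧ z.2.2 < z.1.2}.indicator
            (1 : (ℝ≥0 × ℝ≥0) × (ℝ≥0 × ℝ≥0) → ℝ≥0∞) (p, q)) =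
            (Ioi q.1 ×ˢ Ioi q.2).indicator 1 := by
          ext p
          simp [indicator]
        rw [this, lintegral_indicator_one (measurableSet_Ioi.prod measurableSet_Ioi)]

/-- Finite measures on the quarter plane that agree on all upper right quadrants and have the same
marginals are equal. -/
theorem Measure.ext_of_Ioi_prod_Ioi {γ γ' : Measure (ℝ≥0 × ℝ≥0)} [IsFiniteMeasure γ]
    [IsFiniteMeasure γ'] (h₁ : γ.map Prod.fst = γ'.map Prod.fst)
    (h₂ : γ.map Prod.snd = γ'.map Prod.snd)
    (h : ∀ u v : ℝ≥0, γ (Ioi u ×ˢ Ioi v) = γ' (Ioi u ×ˢ Ioi v)) : γ = γ' := by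
  have fst_eq : ∀ {A : Set ℝ≥0}, MeasurableSet A → γ (A ×ˢ univ) = γ' (A ×ˢ univ) := by
    intro A hA
    have := congrArg (fun m => m A) h₁
    simpa [Measure.map_apply measurable_fst hA, prod_univ] using this
  have snd_eq : ∀ {A : Set ℝ≥0}, MeasurableSet A → γ (univ ×ˢ A) = γ' (univ ×ˢ A) := by
    intro A hA
    have := congrArg (fun m => m A) h₂
    simpa [Measure.map_apply measurable_snd hA, univ_prod] using this
  have key : ∀ (m : Measure (ℝ≥0 × ℝ≥0)) [IsFiniteMeasure m] (A : Set ℝ≥0) (v : ℝ≥0),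
      m (A ×ˢ Iic v) = m (A ×ˢ univ) - m (A ×ˢ Ioi v) := by
    intro m _ A v
    have hd : MeasurableSet (univ ×ˢ Ioi v : Set (ℝ≥0 × ℝ≥0)) :=
      MeasurableSet.univ.prod measurableSet_Ioi
    have h1 := measure_inter_add_sdiff (μ := m) (A ×ˢ univ) hd
    have e1 : A ×ˢ univ ∩ univ ×ˢ Ioi v = A ×ˢ Ioi v := by ext p; simp
    have e2 : (A ×ˢ univ) \ (univ ×ˢ Ioi v) = A ×ˢ Iic v := by ext p; simp
    rw [e1, e2] at h1
    rw [← h1, ENNReal.add_sub_cancel_left (measure_ne_top _ _)]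
  have key' : ∀ (m : Measure (ℝ≥0 × ℝ≥0)) [IsFiniteMeasure m] (B : Set ℝ≥0) (u : ℝ≥0),
      m (Iic u ×ˢ B) = m (univ ×ˢ B) - m (Ioi u ×ˢ B) := by
    intro m _ B u
    have hd : MeasurableSet (Ioi u ×ˢ univ : Set (ℝ≥0 × ℝ≥0)) :=
      measurableSet_Ioi.prod MeasurableSet.univ
    have h1 := measure_inter_add_sdiff (μ := m) (univ ×ˢ B) hd
    have e1 : univ ×ˢ B ∩ Ioi u ×ˢ univ = Ioi u ×ˢ B := by ext p; simp; tauto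
    have e2 : (univ ×ˢ B) \ (Ioi u ×ˢ univ) = Iic u ×ˢ B := by ext p; simp; tauto
    rw [e1, e2] at h1
    rw [← h1, ENNReal.add_sub_cancel_left (measure_ne_top _ _)]
  -- Half-lines are replaced by arbitrary measurable sets one coordinate at a time, each time by
  -- comparing the restricted marginals on the sets `Iic`.
  have step1 : ∀ (u : ℝ≥0) {B : Set ℝ≥0}, MeasurableSet B →
      γ (Ioi u ×ˢ B) = γ' (Ioi u ×ˢ B) := by
    intro u B hB
    have e : (γ.restrict (Ioi u ×ˢ univ)).map Prod.snd =
        (γ'.restrict (Ioi u ×ˢ univ)).map Prod.snd := by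
      refine Measure.ext_of_Iic _ _ fun v => ?_
      rw [Measure.map_apply measurable_snd measurableSet_Iic,
        Measure.map_apply measurable_snd measurableSet_Iic,
        Measure.restrict_apply (measurable_snd measurableSet_Iic),
        Measure.restrict_apply (measurable_snd measurableSet_Iic)]
      have : Prod.snd ⁻¹' Iic v ∩ Ioi u ×ˢ univ = Ioi u ×ˢ Iic v := by ext p; simp; tauto
      rw [this, key γ, key γ', h, fst_eq measurableSet_Ioi]
    have := congrArg (fun m => m B) e
    simp only [Measure.map_apply measurable_snd hB,
        Measure.restrict_apply (measurable_snd hB)] at this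
    have e' : Prod.snd ⁻¹' B ∩ Ioi u ×ˢ univ = Ioi u ×ˢ B := by ext p; simp; tauto
    rwa [e'] at this
  refine Measure.ext_prod fun {A B} hA hB => ?_
  have e : (γ.restrict (univ ×ˢ B)).map Prod.fst = (γ'.restrict (univ ×ˢ B)).map Prod.fst := by
    refine Measure.ext_of_Iic _ _ fun u => ?_
    rw [Measure.map_apply measurable_fst measurableSet_Iic,
      Measure.map_apply measurable_fst measurableSet_Iic,
      Measure.restrict_apply (measurable_fst measurableSet_Iic),
      Measure.restrict_apply (measurable_fst measurableSet_Iic)]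
    have : Prod.fst ⁻¹' Iic u ∩ univ ×ˢ B = Iic u ×ˢ B := by ext p; simp
    rw [this, key' γ, key' γ', step1 u hB, snd_eq hB]
  have := congrArg (fun m => m A) e
  simp only [Measure.map_apply measurable_fst hA,
      Measure.restrict_apply (measurable_fst hA)] at this
  have e' : Prod.fst ⁻¹' A ∩ univ ×ˢ B = A ×ˢ B := by ext p; simp
  rwa [e'] at this

/-- Stated additively because subtraction truncates in `ℝ≥0∞`; with the marginals fixed, it trades
the quadratic cost for the product. -/
theorem NNReal.edist_sq_add_two_mul (a b : ℝ≥0) :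
    edist a b ^ 2 + 2 * ((a : ℝ≥0∞) * b) = (a : ℝ≥0∞) ^ 2 + (b : ℝ≥0∞) ^ 2 := by
  rw [edist_nndist]
  norm_cast
  ext
  push_cast
  rw [NNReal.dist_eq, sq_abs]
  ring

/-- Among the couplings of given marginals, the one carried by the graph of a map that is monotone
off a null set gives the greatest mass to upper right quadrants. -/
theorem measure_Ioi_prod_Ioi_le_of_monotoneOn {ν : Measure ℝ≥0} {G : ℝ≥0 → ℝ≥0}
    (hG : Measurable G) {E : Set ℝ≥0} (hE : ∀ᵐ r ∂ν, r ∈ E) (hmono : MonotoneOn G E)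
    {γ : Measure (ℝ≥0 × ℝ≥0)} (hγ : γ ∈ couplings ν (ν.map G)) (u v : ℝ≥0) :
    γ (Ioi u ×ˢ Ioi v) ≤ (ν.map fun r => (r, G r)) (Ioi u ×ˢ Ioi v) := by
  rw [Measure.map_apply (by fun_prop) (measurableSet_Ioi.prod measurableSet_Ioi)]
  -- By monotonicity such an `r` makes `G x > v` imply `x > u` almost everywhere, so the graph gives
  -- the quadrant the full second marginal mass. Without such an `r` it gives the full first one.
  by_cases h : ∃ r ∈ E, u < r ∧ G r ≤ v
  · obtain ⟨r, hrE, hur, hrv⟩ := h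
    calc γ (Ioi u ×ˢ Ioi v) ≤ γ (Prod.snd ⁻¹' Ioi v) := measure_mono fun p hp => hp.2
      _ = ν (G ⁻¹' Ioi v) := by
        rw [← Measure.map_apply measurable_snd measurableSet_Ioi, hγ.2,
          Measure.map_apply hG measurableSet_Ioi]
      _ ≤ _ := by
        refine measure_mono_ae ?_
        filter_upwards [hE] with x hx hxv
        refine ⟨?_, hxv⟩
        by_contra hxu
        have hxr : x ≤ r := (not_lt.1 hxu).trans hur.le
        exact absurd ((hmono hx hrE hxr).trans hrv) (not_le.2 hxv)
  · push Not at h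
    calc γ (Ioi u ×ˢ Ioi v) ≤ γ (Prod.fst ⁻¹' Ioi u) := measure_mono fun p hp => hp.1
      _ = ν (Ioi u) := by
        rw [← Measure.map_apply measurable_fst measurableSet_Ioi, hγ.1]
      _ ≤ _ := by
        refine measure_mono_ae ?_
        filter_upwards [hE] with x hx hxu
        exact ⟨hxu, h x hx hxu⟩

theorem map_graph_mem_couplings {X : Type*} [MeasurableSpace X] (μ : Measure X) {T : X → X}
    (hT : Measurable T) : (μ.map fun x => (x, T x)) ∈ couplings μ (μ.map T) := by
  constructor
  · rw [Measure.map_map measurable_fst (by fun_prop)]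
    exact Measure.map_id
  · rw [Measure.map_map measurable_snd (by fun_prop)]
    rfl

theorem isFiniteMeasure_of_mem_couplings {X : Type*} [MeasurableSpace X] {μ ν : Measure X}
    [IsFiniteMeasure μ] {γ : Measure (X × X)} (hγ : γ ∈ couplings μ ν) : IsFiniteMeasure γ := by
  constructor
  rw [← preimage_univ (f := Prod.fst), ← Measure.map_apply measurable_fst .univ, hγ.1]
  exact measure_lt_top _ _

theorem lintegral_edist_sq_add_of_mem_couplings {ν ν' : Measure ℝ≥0}
    {γ : Measure (ℝ≥0 × ℝ≥0)} (hγ : γ ∈ couplings ν ν') :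
    ∫⁻ p, edist p.1 p.2 ^ 2 ∂γ + 2 * ∫⁻ p, (p.1 : ℝ≥0∞) * p.2 ∂γ =
      ∫⁻ r, (r : ℝ≥0∞) ^ 2 ∂ν + ∫⁻ r, (r : ℝ≥0∞) ^ 2 ∂ν' := by
  rw [← lintegral_const_mul _ (by fun_prop), ← lintegral_add_right _ (by fun_prop)]
  simp_rw [NNReal.edist_sq_add_two_mul]
  rw [lintegral_add_right _ (by fun_prop), ← hγ.1, ← hγ.2, lintegral_map (by fun_prop) (by fun_prop),
    lintegral_map (by fun_prop) (by fun_prop)]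

section Rearrangement

variable {ν : Measure ℝ≥0} [IsFiniteMeasure ν] {G : ℝ≥0 → ℝ≥0} {E : Set ℝ≥0}
  {γ : Measure (ℝ≥0 × ℝ≥0)}

theorem lintegral_mul_le_of_monotoneOn (hG : Measurable G) (hE : ∀ᵐ r ∂ν, r ∈ E)
    (hmono : MonotoneOn G E) (hγ : γ ∈ couplings ν (ν.map G)) :
    ∫⁻ p, (p.1 : ℝ≥0∞) * p.2 ∂γ ≤ ∫⁻ r, (r : ℝ≥0∞) * G r ∂ν := by
  have := isFiniteMeasure_of_mem_couplings hγ
  have e : ∫⁻ r, (r : ℝ≥0∞) * G r ∂ν =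
      ∫⁻ p, (p.1 : ℝ≥0∞) * p.2 ∂(ν.map fun r => (r, G r)) := by
    rw [lintegral_map (by fun_prop) (by fun_prop)]
  rw [e, lintegral_mul_eq_lintegral_measure_Ioi, lintegral_mul_eq_lintegral_measure_Ioi]
  exact lintegral_mono fun q => measure_Ioi_prod_Ioi_le_of_monotoneOn hG hE hmono hγ _ _

theorem measurable_measure_Ioi_prod_Ioi (γ : Measure (ℝ≥0 × ℝ≥0)) [IsFiniteMeasure γ] :
    Measurable fun q : ℝ≥0 × ℝ≥0 => γ (Ioi q.1 ×ˢ Ioi q.2) := by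
  have hset : MeasurableSet {z : (ℝ≥0 × ℝ≥0) × (ℝ≥0 × ℝ≥0) | z.1.1 < z.2.1 ∧ z.1.2 < z.2.2} :=
    (measurableSet_lt (by fun_prop) (by fun_prop)).inter
      (measurableSet_lt (by fun_prop) (by fun_prop))
  exact measurable_measure_prodMk_left (ν := γ) hset

/-- Uniqueness of the maximiser in the rearrangement inequality. -/
theorem eq_map_graph_of_lintegral_mul_le (hG : Measurable G) (hE : ∀ᵐ r ∂ν, r ∈ E)
    (hmono : MonotoneOn G E) (hγ : γ ∈ couplings ν (ν.map G))
    (hfin : ∫⁻ p, (p.1 : ℝ≥0∞) * p.2 ∂γ ≠ ∞)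
    (h : ∫⁻ r, (r : ℝ≥0∞) * G r ∂ν ≤ ∫⁻ p, (p.1 : ℝ≥0∞) * p.2 ∂γ) :
    γ = ν.map fun r => (r, G r) := by
  have := isFiniteMeasure_of_mem_couplings hγ
  have hγ' := map_graph_mem_couplings ν hG
  have e : ∫⁻ r, (r : ℝ≥0∞) * G r ∂ν =
      ∫⁻ p, (p.1 : ℝ≥0∞) * p.2 ∂(ν.map fun r => (r, G r)) := by
    rw [lintegral_map (by fun_prop) (by fun_prop)]
  have hle := measure_Ioi_prod_Ioi_le_of_monotoneOn hG hE hmono hγ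
  rw [e, lintegral_mul_eq_lintegral_measure_Ioi, lintegral_mul_eq_lintegral_measure_Ioi] at h
  rw [lintegral_mul_eq_lintegral_measure_Ioi] at hfin
  have hae := ae_eq_of_ae_le_of_lintegral_le (ae_of_all _ fun q : ℝ≥0 × ℝ≥0 => hle q.1 q.2) hfin
    (measurable_measure_Ioi_prod_Ioi _).aemeasurable h
  refine Measure.ext_of_Ioi_prod_Ioi (hγ.1.trans hγ'.1.symm) (hγ.2.trans hγ'.2.symm)
    fun u v => (hle u v).antisymm ?_
  -- Equality almost everywhere becomes equality everywhere: the quadrant at (u, v) is the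
  -- increasing union of those at (aₙ, bₙ), and each rectangle between them has positive measure,
  -- hence contains a point of equality.
  obtain ⟨a, ha, hua, hta⟩ := exists_seq_strictAnti_tendsto u
  obtain ⟨b, hb, hvb, htb⟩ := exists_seq_strictAnti_tendsto v
  have hU : Ioi u ×ˢ Ioi v = ⋃ n, Ioi (a n) ×ˢ Ioi (b n) := by
    ext p
    simp only [mem_prod, mem_Ioi, mem_iUnion]
    constructor
    · rintro ⟨h1, h2⟩
      exact ((hta.eventually (gt_mem_nhds h1)).and (htb.eventually (gt_mem_nhds h2))).exists
    · rintro ⟨n, h1, h2⟩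
      exact ⟨(hua n).trans h1, (hvb n).trans h2⟩
  have hM : Monotone fun n => Ioi (a n) ×ˢ Ioi (b n) := fun m n hmn =>
    prod_mono (Ioi_subset_Ioi (ha.antitone hmn)) (Ioi_subset_Ioi (hb.antitone hmn))
  rw [hU, hM.measure_iUnion, ← hU]
  refine iSup_le fun n => ?_
  have hpos : (halfLineVolume.prod halfLineVolume) (Ioo u (a n) ×ˢ Ioo v (b n)) ≠ 0 := by
    rw [Measure.prod_prod]
    exact mul_ne_zero (halfLineVolume_Ioo_pos (hua n)).ne' (halfLineVolume_Ioo_pos (hvb n)).ne'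
  obtain ⟨q, hq, hqe⟩ := ((frequently_ae_mem_iff.2 hpos).and_eventually hae).exists
  calc _ ≤ (ν.map fun r => (r, G r)) (Ioi q.1 ×ˢ Ioi q.2) :=
        measure_mono (prod_mono (Ioi_subset_Ioi hq.1.2.le) (Ioi_subset_Ioi hq.2.2.le))
    _ = γ (Ioi q.1 ×ˢ Ioi q.2) := hqe.symm
    _ ≤ _ := measure_mono (prod_mono (Ioi_subset_Ioi hq.1.1.le) (Ioi_subset_Ioi hq.2.1.le))

/-- On the half-line, a map that is monotone off a null set is optimal for the quadratic cost. -/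
theorem lintegral_edist_sq_le_of_monotoneOn (hG : Measurable G) (hE : ∀ᵐ r ∂ν, r ∈ E)
    (hmono : MonotoneOn G E) (hγ : γ ∈ couplings ν (ν.map G))
    (h₀ : ∫⁻ r, (r : ℝ≥0∞) ^ 2 ∂ν ≠ ∞) (h₁ : ∫⁻ r, (r : ℝ≥0∞) ^ 2 ∂(ν.map G) ≠ ∞) :
    ∫⁻ r, edist r (G r) ^ 2 ∂ν ≤ ∫⁻ p, edist p.1 p.2 ^ 2 ∂γ ∧
      (∫⁻ p, edist p.1 p.2 ^ 2 ∂γ ≤ ∫⁻ r, edist r (G r) ^ 2 ∂ν → ∀ᵐ p ∂γ, p.2 = G p.1) := by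
  have hle := lintegral_mul_le_of_monotoneOn hG hE hmono hγ
  have e1 := lintegral_edist_sq_add_of_mem_couplings hγ
  have e2 := lintegral_edist_sq_add_of_mem_couplings (map_graph_mem_couplings ν hG)
  rw [lintegral_map (by fun_prop) (by fun_prop), lintegral_map (by fun_prop) (by fun_prop),
    ← e1] at e2
  have hfin : ∫⁻ p, edist p.1 p.2 ^ 2 ∂γ + 2 * ∫⁻ p, (p.1 : ℝ≥0∞) * p.2 ∂γ ≠ ∞ := by
    rw [e1]; exact ENNReal.add_ne_top.2 ⟨h₀, h₁⟩
  have hfin2 := hfin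
  rw [← e2] at hfin2
  have t1 := (ENNReal.add_ne_top.1 hfin).1
  have t2 : ∫⁻ p, (p.1 : ℝ≥0∞) * p.2 ∂γ ≠ ∞ := fun h =>
    (ENNReal.add_ne_top.1 hfin).2 (by simp [h])
  have t3 := (ENNReal.add_ne_top.1 hfin2).1
  have t4 : ∫⁻ r, (r : ℝ≥0∞) * G r ∂ν ≠ ∞ := fun h =>
    (ENNReal.add_ne_top.1 hfin2).2 (by simp [h])
  -- Cost plus twice the product is the same finite number for both couplings, so the comparison can
  -- be subtracted in ℝ.
  have hcancel : ∫⁻ r, edist r (G r) ^ 2 ∂ν ≤ ∫⁻ p, edist p.1 p.2 ^ 2 ∂γ := by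
    lift ∫⁻ r, edist r (G r) ^ 2 ∂ν to ℝ≥0 using t3 with a
    lift ∫⁻ p, edist p.1 p.2 ^ 2 ∂γ to ℝ≥0 using t1 with b
    lift ∫⁻ r, (r : ℝ≥0∞) * G r ∂ν to ℝ≥0 using t4 with c
    lift ∫⁻ p, (p.1 : ℝ≥0∞) * p.2 ∂γ to ℝ≥0 using t2 with d
    norm_cast at *
    rw [← NNReal.coe_inj] at e2
    rw [← NNReal.coe_le_coe] at hle ⊢
    push_cast at e2
    linarith
  refine ⟨hcancel, fun hge => ?_⟩
  have heq := hcancel.antisymm hge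
  rw [heq] at e2
  have e3 := (ENNReal.add_right_inj t1).1 e2
  have e4 : ∫⁻ r, (r : ℝ≥0∞) * G r ∂ν = ∫⁻ p, (p.1 : ℝ≥0∞) * p.2 ∂γ :=
    (ENNReal.mul_right_inj two_ne_zero ENNReal.ofNat_ne_top).1 e3
  rw [eq_map_graph_of_lintegral_mul_le hG hE hmono hγ t2 e4.le]
  rw [ae_map_iff (by fun_prop) (measurableSet_eq_fun (by fun_prop) (by fun_prop))]
  simp

end Rearrangement

/-- A coupling of least cost computes the Wasserstein distance. -/
theorem wassersteinTwo_sq_eq {X : Type*} [PseudoEMetricSpace X] [MeasurableSpace X]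
    {μ ν : Measure X} {γ₀ : Measure (X × X)} (h₀ : γ₀ ∈ couplings μ ν)
    (h : ∀ γ ∈ couplings μ ν, ∫⁻ p, edist p.1 p.2 ^ 2 ∂γ₀ ≤ ∫⁻ p, edist p.1 p.2 ^ 2 ∂γ) :
    wassersteinTwo μ ν ^ 2 = ∫⁻ p, edist p.1 p.2 ^ 2 ∂γ₀ := by
  rw [wassersteinTwo, ← ENNReal.rpow_natCast, ← ENNReal.rpow_mul]
  norm_num
  exact (iInf₂_le γ₀ h₀).antisymm (le_iInf₂ h)

/-! ### Distribution functions of atomless measures -/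

section DistributionFunction

variable (ν : Measure ℝ≥0) [IsFiniteMeasure ν] [NullSingletonClass ν]

theorem continuous_measure_Iic : Continuous fun r : ℝ≥0 => ν (Iic r) := by
  have hnull : NullSingletonClass (ν.map ((↑) : ℝ≥0 → ℝ)) := by
    refine ⟨fun x => ?_⟩
    rw [Measure.map_apply measurable_coe_nnreal_real (measurableSet_singleton x)]
    exact Set.Subsingleton.measure_zero (fun a ha b hb => NNReal.coe_injective
      ((show (a : ℝ) = x from ha).trans (show (b : ℝ) = x from hb).symm)) ν
  -- The base point -1 lies left of the half-line, so the primitive at `r` collects all the mass of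
  -- `Iic r`.
  have hc := intervalIntegral.continuous_primitive (μ := ν.map ((↑) : ℝ≥0 → ℝ))
    (f := fun _ => (1 : ℝ)) (fun a b => intervalIntegrable_const) (-1)
  have e : (fun r : ℝ≥0 => ν (Iic r)) = fun r : ℝ≥0 =>
      ENNReal.ofReal (∫ _ in (-1 : ℝ)..r, (1 : ℝ) ∂(ν.map ((↑) : ℝ≥0 → ℝ))) := by
    ext r
    rw [intervalIntegral.integral_of_le (by linarith [r.2, NNReal.coe_nonneg r])]
    simp only [integral_const, smul_eq_mul, mul_one, MeasurableSet.univ, measureReal_restrict_apply,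
      univ_inter]
    rw [ofReal_measureReal, Measure.map_apply measurable_coe_nnreal_real measurableSet_Ioc]
    congr 1
    ext x
    simp only [mem_Iic, mem_preimage, mem_Ioc]
    exact ⟨fun h => ⟨by linarith [NNReal.coe_nonneg x], by exact_mod_cast h⟩,
      fun h => by exact_mod_cast h.2⟩
  rw [e]
  exact ENNReal.continuous_ofReal.comp (hc.comp NNReal.continuous_coe)

omit [IsFiniteMeasure ν] [NullSingletonClass ν] in
theorem monotone_measure_Iic : Monotone fun r : ℝ≥0 => ν (Iic r) :=
  fun _ _ h => measure_mono (Iic_subset_Iic.2 h)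

/-- Intermediate values. The inequality is strict because the total mass may be reached only in the
limit. -/
theorem exists_measure_Iic_eq {y : ℝ≥0∞} (hy : y < ν univ) : ∃ R : ℝ≥0, ν (Iic R) = y := by
  refine mem_range_of_exists_le_of_exists_ge (continuous_measure_Iic ν) ⟨0, ?_⟩ ?_
  · have : Iic (0 : ℝ≥0) = {0} := by ext x; simp
    simp [this]
  · have hU : (⋃ n : ℕ, Iic (n : ℝ≥0)) = univ := by
      refine eq_univ_of_forall fun x => mem_iUnion.2 ?_
      obtain ⟨n, hn⟩ := exists_nat_ge x
      exact ⟨n, hn⟩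
    have hM : Monotone fun n : ℕ => Iic (n : ℝ≥0) :=
      fun m n h => Iic_subset_Iic.2 (by exact_mod_cast h)
    rw [← hU, hM.measure_iUnion] at hy
    obtain ⟨n, hn⟩ := lt_iSup_iff.1 hy
    exact ⟨n, hn.le⟩

/-- Each bounded piece of the level set has a least and a greatest point, and no mass lies between
two points of equal level. -/
theorem measure_setOf_measure_Iic_eq (y : ℝ≥0∞) : ν {r | ν (Iic r) = y} = 0 := by
  set S := {r | ν (Iic r) = y} with hS
  have hclosed : IsClosed S := isClosed_eq (continuous_measure_Iic ν) continuous_const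
  have hU : S = ⋃ n : ℕ, S ∩ Icc 0 (n : ℝ≥0) := by
    rw [← inter_iUnion]
    refine (inter_eq_left.2 fun x _ => mem_iUnion.2 ?_).symm
    obtain ⟨n, hn⟩ := exists_nat_ge x
    exact ⟨n, zero_le, hn⟩
  rw [hU]
  refine measure_iUnion_null fun n => ?_
  have hc : IsCompact (S ∩ Icc 0 (n : ℝ≥0)) := isCompact_Icc.inter_left hclosed
  rcases (S ∩ Icc 0 (n : ℝ≥0)).eq_empty_or_nonempty with he | hne
  · simp [he]
  obtain ⟨a, ha⟩ := hc.exists_isLeast hne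
  obtain ⟨b, hb⟩ := hc.exists_isGreatest hne
  refine measure_mono_null (t := {a} ∪ Iic b \ Iic a) (fun x hx => ?_) ?_
  · rcases (ha.2 hx).eq_or_lt with h | h
    · exact Or.inl h.symm
    · exact Or.inr ⟨hb.2 hx, not_le.2 h⟩
  · refine measure_union_null (measure_singleton a) ?_
    have e1 : ν (Iic a) = y := ha.1.1
    have e2 : ν (Iic b) = y := hb.1.1
    rw [measure_sdiff (Iic_subset_Iic.2 (ha.2 hb.1)) measurableSet_Iic.nullMeasurableSet
      (measure_ne_top _ _), e1, e2, tsub_self]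

/-- Off a null set, the distribution function is strictly increasing. -/
theorem ae_strictMono_measure_Iic : ∀ᵐ r ∂ν,
    (∀ R, r < R → ν (Iic r) < ν (Iic R)) ∧ ∀ R, R < r → ν (Iic R) < ν (Iic r) := by
  -- A failure of strictness at `r` makes the function constant on an interval with endpoint `r`,
  -- which contains a rational; so only countably many null level sets must be avoided.
  have h : ∀ᵐ r ∂ν, ∀ q : ℚ≥0, ν (Iic r) ≠ ν (Iic (q : ℝ≥0)) :=
    ae_all_iff.2 fun q => by
      rw [ae_iff]
      simpa using measure_setOf_measure_Iic_eq ν (ν (Iic (q : ℝ≥0)))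
  filter_upwards [h] with r hr
  have hm := monotone_measure_Iic ν
  have hq : ∀ {a b : ℝ≥0}, a < b → ∃ q : ℚ≥0, a < (q : ℝ≥0) ∧ (q : ℝ≥0) < b := by
    intro a b hab
    obtain ⟨q, h1, h2⟩ := exists_rat_btwn (NNReal.coe_lt_coe.2 hab)
    have hq0 : 0 ≤ q := by exact_mod_cast (a.2.trans h1.le)
    lift q to ℚ≥0 using hq0
    exact ⟨q, by rw [← NNReal.coe_lt_coe]; exact_mod_cast h1,
      by rw [← NNReal.coe_lt_coe]; exact_mod_cast h2⟩
  constructor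
  · intro R hR
    obtain ⟨q, h1, h2⟩ := hq hR
    exact (lt_of_le_of_ne (hm h1.le) (hr q)).trans_le (hm h2.le)
  · intro R hR
    obtain ⟨q, h1, h2⟩ := hq hR
    exact (hm h1.le).trans_lt (lt_of_le_of_ne (hm h2.le) (hr q).symm)

end DistributionFunction

/-! ### The matching function C -/

theorem monotone_measure_setOf_coe_le (ν : Measure ℝ≥0) :
    Monotone fun x : ℝ≥0∞ => ν {s : ℝ≥0 | (s : ℝ≥0∞) ≤ x} :=
  fun _ _ h => measure_mono fun _ hs => le_trans hs h

theorem exists_monotone_measure_matching (ν₀ ν₁ : Measure ℝ≥0) [IsFiniteMeasure ν₁]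
    [NullSingletonClass ν₁] (h : ν₀ univ = ν₁ univ) :
    ∃ C : ℝ≥0 → ℝ≥0∞, Monotone C ∧
      ∀ R, ν₀ (Iic R) = ν₁ {s : ℝ≥0 | (s : ℝ≥0∞) ≤ C R} := by
  have hs : ∀ y ≤ ν₁ univ, ∃ x : ℝ≥0∞, ν₁ {s : ℝ≥0 | (s : ℝ≥0∞) ≤ x} = y := by
    intro y hy
    rcases hy.eq_or_lt with rfl | hy
    · exact ⟨∞, by simp⟩
    · obtain ⟨R, hR⟩ := exists_measure_Iic_eq ν₁ hy
      refine ⟨R, ?_⟩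
      simpa [Iic] using hR
  choose! x hx using hs
  have hle : ∀ R, ν₀ (Iic R) ≤ ν₁ univ := fun R => h ▸ measure_mono (subset_univ _)
  refine ⟨fun R => x (ν₀ (Iic R)), fun R R' hR => ?_, fun R => (hx _ (hle R)).symm⟩
  rcases (monotone_measure_Iic ν₀ hR).eq_or_lt with he | hlt
  · exact le_of_eq (congrArg x he)
  · refine le_of_not_gt fun hgt => ?_
    have := monotone_measure_setOf_coe_le ν₁ hgt.le
    simp only [hx _ (hle _)] at this
    exact absurd hlt (not_lt.2 this)

section Matching

variable {ν₀ ν₁ : Measure ℝ≥0} [IsFiniteMeasure ν₀] [NullSingletonClass ν₀] {C : ℝ≥0 → ℝ≥0∞}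

/-- An infinite value at `r` means that `Iic r` already has full mass, against strict increase to
the right of `r`. -/
theorem ae_ne_top_of_measure_matching (h : ν₀ univ = ν₁ univ)
    (hC : ∀ R, ν₀ (Iic R) = ν₁ {s : ℝ≥0 | (s : ℝ≥0∞) ≤ C R}) : ∀ᵐ r ∂ν₀, C r ≠ ∞ := by
  filter_upwards [ae_strictMono_measure_Iic ν₀] with r hr htop
  have h1 := hC r
  simp only [htop, le_top, ofPred_true, ← h] at h1
  exact absurd (hr.1 (r + 1) (by simp)) (not_lt.2 (h1 ▸ measure_mono (subset_univ _)))

/-- A descent of `C` from `r` to a later point forces equal levels at both, which strict increase to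
the right of `r` excludes. -/
theorem exists_monotoneOn_of_measure_matching (h : ν₀ univ = ν₁ univ)
    (hC : ∀ R, ν₀ (Iic R) = ν₁ {s : ℝ≥0 | (s : ℝ≥0∞) ≤ C R}) :
    ∃ E : Set ℝ≥0, (∀ᵐ r ∂ν₀, r ∈ E) ∧ MonotoneOn (fun r => (C r).toNNReal) E := by
  refine ⟨{r | C r ≠ ∞ ∧ ∀ R, r < R → ν₀ (Iic r) < ν₀ (Iic R)}, ?_, ?_⟩
  · filter_upwards [ae_ne_top_of_measure_matching h hC, ae_strictMono_measure_Iic ν₀] with r h1 h2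
    exact ⟨h1, h2.1⟩
  · intro r hr r' hr' hrr'
    rcases hrr'.eq_or_lt with rfl | hlt
    · exact le_rfl
    · refine ENNReal.toNNReal_mono hr'.1 (le_of_not_gt fun hgt => ?_)
      have := monotone_measure_setOf_coe_le ν₁ hgt.le
      simp only [← hC] at this
      exact absurd (hr.2 r' hlt) (not_lt.2 this)

theorem map_toNNReal_of_measure_matching [IsFiniteMeasure ν₁] (h : ν₀ univ = ν₁ univ)
    (hC : ∀ R, ν₀ (Iic R) = ν₁ {s : ℝ≥0 | (s : ℝ≥0∞) ≤ C R}) (hmeas : Measurable C) :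
    ν₀.map (fun r => (C r).toNNReal) = ν₁ := by
  refine Measure.ext_of_Iic _ _ fun s => ?_
  rw [Measure.map_apply hmeas.ennreal_toNNReal measurableSet_Iic]
  have hs : ν₁ (Iic s) = ν₁ {s' : ℝ≥0 | (s' : ℝ≥0∞) ≤ (s : ℝ≥0∞)} := by simp [Iic]
  have hlt : ∀ r, ν₀ (Iic r) < ν₁ (Iic s) → C r ≤ s := fun r hr => le_of_not_gt fun hgt =>
    absurd (monotone_measure_setOf_coe_le ν₁ hgt.le) (not_le.2 (by beta_reduce; rw [← hC, ← hs]; exact hr))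
  rcases (measure_mono (subset_univ (Iic s)) : ν₁ (Iic s) ≤ ν₁ univ).eq_or_lt with he | hy
  -- No finite radius need realise the full mass, but almost every `r` has a strictly smaller level.
  · rw [he, ← h]
    refine measure_congr ?_
    filter_upwards [ae_strictMono_measure_Iic ν₀] with r hr
    refine propext ⟨fun _ => trivial, fun _ => ?_⟩
    refine ENNReal.toNNReal_mono ENNReal.coe_ne_top (hlt r ?_)
    rw [he, ← h]
    exact (hr.1 (r + 1) (by simp)).trans_le (measure_mono (subset_univ _))
  · rw [← h] at hy
    obtain ⟨R, hR⟩ := exists_measure_Iic_eq ν₀ hy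
    rw [← hR]
    refine measure_congr ?_
    have hne : ∀ᵐ r ∂ν₀, r ≠ R := by simp [ae_iff]
    filter_upwards [ae_strictMono_measure_Iic ν₀, hne,
      ae_ne_top_of_measure_matching h hC] with r hr hrR htop
    refine propext ⟨fun hle => ?_, fun hle => ?_⟩
    · refine le_of_not_gt fun hgt => ?_
      have hle' : C r ≤ s := by
        rw [← ENNReal.coe_toNNReal htop]
        exact_mod_cast hle
      have := monotone_measure_setOf_coe_le ν₁ hle'
      simp only [← hC, ← hs, ← hR] at this
      exact absurd (hr.2 R hgt) (not_lt.2 this)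
    · refine ENNReal.toNNReal_mono ENNReal.coe_ne_top (hlt r ?_)
      rw [← hR]
      exact hr.1 R (lt_of_le_of_ne hle hrR)

end Matching

/-! ### Radial measures and their interpolation -/

instance (d : ℕ) (ρ : ℝ≥0 → ℝ≥0) : NullSingletonClass (radialMeasure d ρ) :=
  ⟨fun x => withDensity_absolutelyContinuous _ _ (measure_singleton x)⟩

instance (d : ℕ) (ρ : ℝ≥0 → ℝ≥0) : SFinite (radialMeasure d ρ) := by
  unfold radialMeasure; infer_instance

theorem matchesRadialMass_iff {d : ℕ} {ρ₀ ρ₁ : ℝ≥0 → ℝ≥0} {C : ℝ≥0 → ℝ≥0∞} :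
    MatchesRadialMass d ρ₀ ρ₁ C ↔ ∀ R, radialMeasure d ρ₀ (Iic R) =
      radialMeasure d ρ₁ {s : ℝ≥0 | (s : ℝ≥0∞) ≤ C R} := by
  refine forall_congr' fun R => ?_
  rw [radialMeasure, radialMeasure, withDensity_apply _ measurableSet_Iic,
    withDensity_apply _ (measurableSet_le (by fun_prop) (by fun_prop))]
  rfl

/-- The image of an absolutely continuous measure under a map that, off a null set, contracts
distances by at most a constant factor is absolutely continuous. -/
theorem map_absolutelyContinuous_of_expanding {ν : Measure ℝ≥0} (hν : ν ≪ halfLineVolume)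
    {g : ℝ≥0 → ℝ≥0} (hg : Measurable g) {E : Set ℝ≥0} (hE : ∀ᵐ r ∂ν, r ∈ E) {K : ℝ≥0}
    (hK : ∀ r ∈ E, ∀ r' ∈ E, r ≤ r' → (r' : ℝ) - r ≤ K * (g r' - g r)) :
    ν.map g ≪ halfLineVolume := by
  have hanti : AntilipschitzWith K fun r : E => (g r : ℝ) := by
    refine AntilipschitzWith.of_le_mul_dist fun r r' => ?_
    rw [Subtype.dist_eq, NNReal.dist_eq, Real.dist_eq]
    rcases le_total (r : ℝ≥0) r' with h | h
    · rw [abs_sub_comm, abs_sub_comm (g r : ℝ), abs_of_nonneg (sub_nonneg.2 (by exact_mod_cast h))]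
      exact (hK r r.2 r' r'.2 h).trans
        (mul_le_mul_of_nonneg_left (le_abs_self _) K.2)
    · rw [abs_of_nonneg (sub_nonneg.2 (by exact_mod_cast h))]
      exact (hK r' r'.2 r r.2 h).trans
        (mul_le_mul_of_nonneg_left (le_abs_self _) K.2)
  refine Measure.AbsolutelyContinuous.mk fun s hs h0 => ?_
  rw [Measure.map_apply hg hs]
  have hsub : ν (g ⁻¹' s) ≤ ν (g ⁻¹' s ∩ E) := by
    refine measure_mono_ae ?_
    filter_upwards [hE] with r hr h using ⟨h, hr⟩
  refine le_antisymm (hsub.trans (le_of_eq (hν ?_))) zero_le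
  -- Lebesgue measure is read as one-dimensional Hausdorff measure, which an antilipschitz map
  -- controls on preimages even if `E` is not measurable.
  rw [halfLineVolume_apply, ← hausdorffMeasure_real] at h0 ⊢
  have hi : Isometry (fun r : E => ((r : ℝ≥0) : ℝ)) := fun _ _ => rfl
  have h1 := hanti.hausdorffMeasure_preimage_le (d := 1) zero_le_one (((↑) : ℝ≥0 → ℝ) '' s)
  rw [h0, mul_zero] at h1
  have h2 := hi.hausdorffMeasure_image (d := 1) (Or.inl zero_le_one)
    ((fun r : E => (g r : ℝ)) ⁻¹' (((↑) : ℝ≥0 → ℝ) '' s))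
  rw [le_antisymm h1 zero_le] at h2
  refine measure_mono_null ?_ h2
  rintro _ ⟨r, ⟨hrs, hrE⟩, rfl⟩
  exact ⟨⟨r, hrE⟩, ⟨g r, hrs, rfl⟩, rfl⟩

theorem exists_radialMeasure_eq (d : ℕ) {ν : Measure ℝ≥0} [IsFiniteMeasure ν]
    (hν : ν ≪ halfLineVolume) : ∃ ρ : ℝ≥0 → ℝ≥0, Measurable ρ ∧ ν = radialMeasure d ρ := by
  -- Dividing by r^(d-1) can go wrong only at the null point 0.
  refine ⟨fun r => (ν.rnDeriv halfLineVolume r).toNNReal / r ^ (d - 1),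
    (Measure.measurable_rnDeriv _ _).ennreal_toNNReal.div (by fun_prop), ?_⟩
  conv_lhs => rw [← Measure.withDensity_rnDeriv_eq ν halfLineVolume hν]
  refine withDensity_congr_ae ?_
  have h0 : ∀ᵐ r ∂halfLineVolume, r ≠ 0 := by simp [ae_iff]
  filter_upwards [Measure.rnDeriv_lt_top ν halfLineVolume, h0] with r hr hr0
  rw [mul_div_cancel₀ _ (pow_ne_zero _ hr0), ENNReal.coe_toNNReal hr.ne]

theorem measurable_radialInterp {C : ℝ≥0 → ℝ≥0∞} (hC : Measurable C) (t : ℝ) :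
    Measurable (radialInterp C t) := by
  unfold radialInterp
  exact (((measurable_const.mul measurable_coe_nnreal_real)).add
    (measurable_const.mul hC.ennreal_toReal)).real_toNNReal

theorem coe_radialInterp {C : ℝ≥0 → ℝ≥0∞} {t : ℝ} (ht : t ∈ Icc (0 : ℝ) 1) (r : ℝ≥0) :
    (radialInterp C t r : ℝ) = (1 - t) * r + t * (C r).toReal :=
  Real.coe_toNNReal _ (add_nonneg (mul_nonneg (sub_nonneg.2 ht.2) r.2)
    (mul_nonneg ht.1 ENNReal.toReal_nonneg))

/-- For t < 1 the term (1 - t) r alone gives the expansion constant (1 - t)⁻¹, as t C is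
nondecreasing off a null set. At t = 1 this constant is lost, but the image is ρ₁^rad itself. -/
theorem exists_map_radialInterp_eq {d : ℕ} {ρ₀ ρ₁ : ℝ≥0 → ℝ≥0} (hρ₁ : Measurable ρ₁)
    [IsFiniteMeasure (radialMeasure d ρ₀)] [IsFiniteMeasure (radialMeasure d ρ₁)]
    (h : radialMeasure d ρ₀ univ = radialMeasure d ρ₁ univ) {C : ℝ≥0 → ℝ≥0∞} (hmeas : Measurable C)
    (hC : MatchesRadialMass d ρ₀ ρ₁ C) {t : ℝ} (ht : t ∈ Icc (0 : ℝ) 1) :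
    ∃ ρt : ℝ≥0 → ℝ≥0, Measurable ρt ∧
      (radialMeasure d ρ₀).map (radialInterp C t) = radialMeasure d ρt := by
  rw [matchesRadialMass_iff] at hC
  rcases ht.2.eq_or_lt with rfl | hlt
  · refine ⟨ρ₁, hρ₁, ?_⟩
    rw [← map_toNNReal_of_measure_matching h hC hmeas]
    congr 1
    ext r
    rw [coe_radialInterp ht]
    simp [ENNReal.toReal]
  · obtain ⟨E, hE, hmono⟩ := exists_monotoneOn_of_measure_matching h hC
    refine exists_radialMeasure_eq d (map_absolutelyContinuous_of_expanding
      (withDensity_absolutelyContinuous _ _) (measurable_radialInterp hmeas t) hE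
      (K := Real.toNNReal (1 - t)⁻¹) fun r hr r' hr' hrr' => ?_)
    have h1 : (0 : ℝ) < 1 - t := by linarith
    have h2 : (C r).toReal ≤ (C r').toReal := by exact_mod_cast hmono hr hr' hrr'
    rw [Real.coe_toNNReal _ (by positivity), coe_radialInterp ht, coe_radialInterp ht,
      inv_mul_eq_div, le_div_iff₀ h1]
    nlinarith [mul_le_mul_of_nonneg_left h2 ht.1]

/-! ### Polar coordinates -/

theorem MeasureTheory.Measure.withDensity_map {X Y : Type*} [MeasurableSpace X] [MeasurableSpace Y]
    (κ : Measure X) {F : X → Y} (hF : Measurable F) {h : Y → ℝ≥0∞} (hh : Measurable h) :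
    (κ.map F).withDensity h = (κ.withDensity (h ∘ F)).map F := by
  ext s hs
  rw [withDensity_apply _ hs, Measure.map_apply hF hs, withDensity_apply _ (hF hs),
    Measure.restrict_map hF hs, lintegral_map hh hF]
  rfl

/-- The inclusion of the open half-line into the closed one. -/
def ioiToNNReal (r : Ioi (0 : ℝ)) : ℝ≥0 := ⟨r, (mem_Ioi.1 r.2).le⟩

theorem measurable_ioiToNNReal : Measurable ioiToNNReal :=
  measurable_subtype_coe.subtype_mk

theorem map_volumeIoiPow (n : ℕ) :
    (Measure.volumeIoiPow n).map ioiToNNReal =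
      halfLineVolume.withDensity fun r => ((r ^ n : ℝ≥0) : ℝ≥0∞) := by
  have h1 : ((volume : Measure ℝ).comap ((↑) : Ioi (0 : ℝ) → ℝ)).map ioiToNNReal =
      halfLineVolume := by
    have hE := measurableEmbedding_coe_nnreal_real
    have : (((volume : Measure ℝ).comap ((↑) : Ioi (0 : ℝ) → ℝ)).map ioiToNNReal).map
        ((↑) : ℝ≥0 → ℝ) = halfLineVolume.map ((↑) : ℝ≥0 → ℝ) := by
      rw [Measure.map_map measurable_coe_nnreal_real measurable_ioiToNNReal, map_coe_halfLineVolume,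
        ← Measure.restrict_congr_set Ioi_ae_eq_Ici]
      exact map_comap_subtype_coe measurableSet_Ioi _
    rw [← hE.comap_map (((volume : Measure ℝ).comap ((↑) : Ioi (0 : ℝ) → ℝ)).map ioiToNNReal),
      this, hE.comap_map]
  rw [← h1, Measure.withDensity_map _ measurable_ioiToNNReal (by fun_prop),
    Measure.volumeIoiPow]
  congr 2
  ext r
  have : ((r : ℝ) ^ n) = ((ioiToNNReal r ^ n : ℝ≥0) : ℝ) := by
    rw [NNReal.coe_pow]; rfl
  simp [this]

section Polar

variable {V : Type*} [NormedAddCommGroup V] [NormedSpace ℝ V] [MeasurableSpace V] [BorelSpace V]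

/-- The distribution of `m + r ω`, where `(ω, r)` is distributed according to `σ ⊗ ν`. -/
noncomputable def radialExtension (σ : Measure (Metric.sphere (0 : V) 1)) (m : V)
    (ν : Measure ℝ≥0) : Measure V :=
  (σ.prod ν).map fun p => (p.2 : ℝ) • (p.1 : V) + m

omit [MeasurableSpace V] [BorelSpace V] in
theorem nnnorm_polar_sub (m : V) (p : Metric.sphere (0 : V) 1 × ℝ≥0) :
    ‖(p.2 : ℝ) • (p.1 : V) + m - m‖₊ = p.2 := by
  ext
  simp [norm_smul]

variable [SecondCountableTopology V]

theorem measurable_polar (m : V) :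
    Measurable fun p : Metric.sphere (0 : V) 1 × ℝ≥0 => (p.2 : ℝ) • (p.1 : V) + m := by
  fun_prop

theorem map_nnnorm_sub_radialExtension (σ : Measure (Metric.sphere (0 : V) 1)) (m : V)
    (ν : Measure ℝ≥0) [SFinite ν] :
    (radialExtension σ m ν).map (fun x => ‖x - m‖₊) = σ univ • ν := by
  rw [radialExtension, Measure.map_map (by fun_prop) (measurable_polar m),
    ← Measure.map_snd_prod]
  congr 1
  ext p : 1
  exact nnnorm_polar_sub m p

/-- In polar coordinates the map is (ω, r) ↦ (ω, g(r)) except at r = 0, where the direction is lost;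
hence the need for no atom there. -/
theorem map_radial_radialExtension (σ : Measure (Metric.sphere (0 : V) 1)) [SFinite σ] (m m' : V)
    (ν : Measure ℝ≥0) [SFinite ν] [NullSingletonClass ν] {g : ℝ≥0 → ℝ≥0} (hg : Measurable g) :
    (radialExtension σ m ν).map (fun x => ((g ‖x - m‖₊ : ℝ) / ‖x - m‖) • (x - m) + m') =
      radialExtension σ m' (ν.map g) := by
  have hT : Measurable fun x : V => ((g ‖x - m‖₊ : ℝ) / ‖x - m‖) • (x - m) + m' := by
    fun_prop
  have hmap : σ.prod (ν.map g) = (σ.prod ν).map (Prod.map id g) := by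
    rw [← Measure.map_prod_map _ _ measurable_id hg, Measure.map_id]
  rw [radialExtension, radialExtension, Measure.map_map hT (measurable_polar m), hmap,
    Measure.map_map (measurable_polar m') (by fun_prop)]
  refine Measure.map_congr ?_
  have h0 : ∀ᵐ r ∂ν, r ≠ 0 := by simp [ae_iff]
  filter_upwards [Measure.quasiMeasurePreserving_snd.ae h0] with p hp
  have hn : ‖(p.2 : ℝ) • (p.1 : V) + m - m‖ = p.2 := congrArg NNReal.toReal (nnnorm_polar_sub m p)
  have hp' : (p.2 : ℝ) ≠ 0 := by exact_mod_cast hp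
  simp only [Function.comp_apply, Prod.map_fst, Prod.map_snd, id, nnnorm_polar_sub, hn]
  rw [add_sub_cancel_right, smul_smul, div_mul_cancel₀ _ hp']

variable [FiniteDimensional ℝ V] [Nontrivial V] (μ : Measure V) [μ.IsAddHaarMeasure]

/-- Polar decomposition about the origin, which is a null point, moved to `m` by translation
invariance. -/
theorem eq_radialExtension_toSphere (m : V) :
    μ = radialExtension μ.toSphere m (halfLineVolume.withDensity
      fun r => ((r ^ (Module.finrank ℝ V - 1) : ℝ≥0) : ℝ≥0∞)) := by
  have h1 := μ.measurePreserving_homeomorphUnitSphereProd.map_eq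
  have h2 : (μ.comap ((↑) : ({0}ᶜ : Set V) → V)) =
      (μ.toSphere.prod (.volumeIoiPow (Module.finrank ℝ V - 1))).map
        (homeomorphUnitSphereProd V).symm := by
    rw [← h1, Measure.map_map (Homeomorph.measurable _) (Homeomorph.measurable _)]
    simp
  have h3 : μ = (μ.comap ((↑) : ({0}ᶜ : Set V) → V)).map (↑) := by
    rw [map_comap_subtype_coe (measurableSet_singleton _).compl, restrict_compl_singleton]
  have hprod : ∀ n, μ.toSphere.prod ((Measure.volumeIoiPow n).map ioiToNNReal) =
      (μ.toSphere.prod (Measure.volumeIoiPow n)).map (Prod.map id ioiToNNReal) := by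
    intro n
    rw [← Measure.map_prod_map _ _ measurable_id measurable_ioiToNNReal, Measure.map_id]
  rw [radialExtension, ← map_volumeIoiPow, hprod,
    Measure.map_map (measurable_polar m) (measurable_id.prodMap measurable_ioiToNNReal)]
  have h4 : μ.map (fun x => x + m) = μ := map_add_right_eq_self μ m
  conv_lhs => rw [← h4, h3, h2]
  rw [Measure.map_map measurable_subtype_coe (Homeomorph.measurable _),
    Measure.map_map (by fun_prop) (measurable_subtype_coe.comp (Homeomorph.measurable _))]
  congr 1

theorem withDensity_radial_eq_radialExtension (m : V) {ρ : ℝ≥0 → ℝ≥0} (hρ : Measurable ρ) :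
    μ.withDensity (fun x => (ρ ‖x - m‖₊ : ℝ≥0∞)) =
      radialExtension μ.toSphere m (radialMeasure (Module.finrank ℝ V) ρ) := by
  conv_lhs => rw [eq_radialExtension_toSphere μ m]
  rw [radialExtension, Measure.withDensity_map _ (measurable_polar m) (by fun_prop),
    radialExtension, radialMeasure]
  congr 1
  have e : ((fun x => (ρ ‖x - m‖₊ : ℝ≥0∞)) ∘ fun p : Metric.sphere (0 : V) 1 × ℝ≥0 =>
      (p.2 : ℝ) • (p.1 : V) + m) = fun p => (ρ p.2 : ℝ≥0∞) := by
    ext p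
    simp only [Function.comp_apply, nnnorm_polar_sub]
  rw [e, ← prod_withDensity_right (by fun_prop : Measurable fun r => (ρ r : ℝ≥0∞)),
    ← withDensity_mul _ (by fun_prop) (by fun_prop)]
  congr 2

end Polar

/-- The area is d times the volume of the unit ball, and Γ(d/2 + 1) = (d/2) Γ(d/2). -/
theorem toSphere_volume_univ {d : ℕ} (hd : 1 ≤ d) :
    (volume : Measure (EuclideanSpace ℝ (Fin d))).toSphere univ =
      ENNReal.ofReal (sphereArea d) := by
  have : Nonempty (Fin d) := ⟨⟨0, hd⟩⟩
  have hd' : (0 : ℝ) < d := by exact_mod_cast hd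
  rw [Measure.toSphere_apply_univ, EuclideanSpace.volume_ball, finrank_euclideanSpace_fin,
    ← ENNReal.ofReal_natCast, Fintype.card_fin, ENNReal.ofReal_one, one_pow, one_mul,
    ← ENNReal.ofReal_mul (by positivity), sphereArea, Real.Gamma_add_one (by positivity),
    Real.sqrt_eq_rpow, ← Real.rpow_natCast, ← Real.rpow_mul Real.pi_pos.le]
  congr 1
  have := (Real.Gamma_pos_of_pos (half_pos hd')).ne'
  rw [one_div_mul_eq_div]
  field_simp

theorem sphereArea_pos {d : ℕ} (hd : 1 ≤ d) : 0 < sphereArea d := by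
  have hd' : (0 : ℝ) < d := by exact_mod_cast hd
  have := Real.Gamma_pos_of_pos (half_pos hd')
  unfold sphereArea
  have := Real.rpow_pos_of_pos Real.pi_pos ((d : ℝ) / 2)
  positivity

/-! ### Centring, and equality in the reverse triangle inequality -/

section SecondMoment

variable {Ω V : Type*} [MeasurableSpace Ω] [NormedAddCommGroup V]

theorem memLp_two_iff_lintegral_enorm_sq {κ : Measure Ω} {f : Ω → V}
    (hf : AEStronglyMeasurable f κ) : MemLp f 2 κ ↔ ∫⁻ ω, ‖f ω‖ₑ ^ 2 ∂κ < ∞ := by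
  rw [MemLp, and_iff_right hf,
    eLpNorm_lt_top_iff_lintegral_rpow_enorm_lt_top two_ne_zero ENNReal.ofNat_ne_top]
  simp

theorem edist_nnnorm_le (x y : V) : edist ‖x‖₊ ‖y‖₊ ≤ edist x y := by
  simpa using lipschitzWith_one_nnnorm.edist_le_mul x y

variable [InnerProductSpace ℝ V]

/-- The cross term is twice the inner product of `a` with the mean of `Z`, hence zero. -/
theorem lintegral_enorm_const_add_sq [CompleteSpace V] {κ : Measure Ω} [IsProbabilityMeasure κ]
    {Z : Ω → V} (hZ : MemLp Z 2 κ) (h0 : ∫ ω, Z ω ∂κ = 0) (a : V) :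
    ∫⁻ ω, ‖a + Z ω‖ₑ ^ 2 ∂κ = ENNReal.ofReal (‖a‖ ^ 2) + ∫⁻ ω, ‖Z ω‖ₑ ^ 2 ∂κ := by
  have hofReal : ∀ {f : Ω → V}, MemLp f 2 κ →
      ∫⁻ ω, ‖f ω‖ₑ ^ 2 ∂κ = ENNReal.ofReal (∫ ω, ‖f ω‖ ^ 2 ∂κ) := by
    intro f hf
    rw [ofReal_integral_eq_lintegral_ofReal hf.integrable_norm_pow' (ae_of_all _ fun _ => by
      positivity)]
    refine lintegral_congr fun ω => ?_
    rw [ENNReal.ofReal_pow (norm_nonneg _), ofReal_norm]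
  have hint : Integrable Z κ := hZ.integrable one_le_two
  have hinner : ∫ ω, inner ℝ a (Z ω) ∂κ = 0 := by
    rw [integral_inner hint, h0, inner_zero_right]
  rw [hofReal (f := fun ω => a + Z ω) ((memLp_const a).add hZ), hofReal hZ,
    ← ENNReal.ofReal_add (by positivity) (integral_nonneg fun _ => by positivity)]
  congr 1
  have hsq : Integrable (fun ω => ‖Z ω‖ ^ 2) κ := hZ.integrable_norm_pow'
  have hi2 : Integrable (fun ω => 2 * inner ℝ a (Z ω)) κ := (hint.const_inner a).const_mul 2
  have h12 : Integrable (fun ω => ‖a‖ ^ 2 + 2 * inner ℝ a (Z ω)) κ := (integrable_const _).add hi2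
  simp_rw [norm_add_sq_real]
  rw [integral_add h12 hsq, integral_add (integrable_const _) hi2,
    integral_const_mul, hinner]
  simp

/-- The quadratic cost of a coupling splits into the cost of the means and the centred cost. -/
theorem lintegral_edist_sq_eq_add_centered [CompleteSpace V] [MeasurableSpace V] [BorelSpace V]
    [SecondCountableTopology V] {μ₀ μ₁ : Measure V} [IsProbabilityMeasure μ₀] {m₀ m₁ : V}
    (h₀ : MemLp (fun x => x - m₀) 2 μ₀) (h₁ : MemLp (fun x => x - m₁) 2 μ₁)
    (h₀' : ∫ x, (x - m₀) ∂μ₀ = 0) (h₁' : ∫ x, (x - m₁) ∂μ₁ = 0)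
    {γ : Measure (V × V)} (hγ : γ ∈ couplings μ₀ μ₁) :
    ∫⁻ p, edist p.1 p.2 ^ 2 ∂γ = ENNReal.ofReal (‖m₀ - m₁‖ ^ 2) +
      ∫⁻ p, edist (p.1 - m₀) (p.2 - m₁) ^ 2 ∂γ := by
  have hprob : IsProbabilityMeasure γ := by
    constructor
    rw [← preimage_univ (f := Prod.fst), ← Measure.map_apply measurable_fst .univ, hγ.1]
    exact measure_univ
  have hp₀ : MeasurePreserving Prod.fst γ μ₀ := ⟨measurable_fst, hγ.1⟩
  have hp₁ : MeasurePreserving Prod.snd γ μ₁ := ⟨measurable_snd, hγ.2⟩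
  have hX : MemLp (fun p : V × V => p.1 - m₀) 2 γ := h₀.comp_measurePreserving hp₀
  have hY : MemLp (fun p : V × V => p.2 - m₁) 2 γ := h₁.comp_measurePreserving hp₁
  have hX0 : ∫ p : V × V, (p.1 - m₀) ∂γ = 0 := by
    rw [← hγ.1, integral_map (by fun_prop) (by fun_prop)] at h₀'
    exact h₀'
  have hY0 : ∫ p : V × V, (p.2 - m₁) ∂γ = 0 := by
    rw [← hγ.2, integral_map (by fun_prop) (by fun_prop)] at h₁'
    exact h₁'
  have hZ0 : ∫ p : V × V, ((p.1 - m₀) - (p.2 - m₁)) ∂γ = 0 := by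
    rw [integral_sub (hX.integrable one_le_two) (hY.integrable one_le_two), hX0, hY0, sub_zero]
  have := lintegral_enorm_const_add_sq (Z := fun p : V × V => (p.1 - m₀) - (p.2 - m₁))
    (hX.sub hY) hZ0 (m₀ - m₁)
  simp_rw [edist_eq_enorm_sub]
  rw [← this]
  refine lintegral_congr fun p => ?_
  congr 2
  abel

/-- After translation, x ↦ -x preserves `μ` and negates the integrand, so the integral is its own
negative; no integrability is needed. -/
theorem integral_sub_center_eq_zero [MeasurableSpace V] [BorelSpace V] [FiniteDimensional ℝ V]
    (μ : Measure V) [μ.IsAddHaarMeasure] (m : V) {ρ : ℝ≥0 → ℝ≥0} (hρ : Measurable ρ) :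
    ∫ x, (x - m) ∂(μ.withDensity fun x => (ρ ‖x - m‖₊ : ℝ≥0∞)) = 0 := by
  rw [integral_withDensity_eq_integral_smul (f := fun x => ρ ‖x - m‖₊) (by fun_prop),
    integral_sub_right_eq_self (fun x => ρ ‖x‖₊ • x) m]
  have h := integral_neg_eq_self (fun x => ρ ‖x‖₊ • x) μ
  simp only [nnnorm_neg, smul_neg, integral_neg] at h
  have h2 : (2 : ℝ) • ∫ x, ρ ‖x‖₊ • x ∂μ = 0 := by
    rw [two_smul]
    nth_rewrite 1 [← h]
    exact neg_add_cancel _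
  exact (smul_eq_zero.1 h2).resolve_left two_ne_zero

theorem edist_div_norm_smul {x : V} (hx : x ≠ 0) (s : ℝ≥0) :
    edist x (((s : ℝ) / ‖x‖) • x) = edist ‖x‖₊ s := by
  have hx' : ‖x‖ ≠ 0 := norm_ne_zero_iff.2 hx
  rw [edist_dist, edist_dist, NNReal.dist_eq, dist_eq_norm, coe_nnnorm]
  congr 1
  have : x - ((s : ℝ) / ‖x‖) • x = ((‖x‖ - s) / ‖x‖) • x := by
    rw [sub_div, div_self hx', sub_smul, one_smul]
  rw [this, norm_smul, norm_div, norm_norm, div_mul_cancel₀ _ hx', Real.norm_eq_abs]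

/-- Squaring the equality gives equality in Cauchy–Schwarz. -/
theorem eq_div_norm_smul_of_edist_eq {x y : V} (hx : x ≠ 0)
    (h : edist ‖x‖₊ ‖y‖₊ = edist x y) : y = (‖y‖ / ‖x‖) • x := by
  have hx' : ‖x‖ ≠ 0 := norm_ne_zero_iff.2 hx
  rw [edist_dist, edist_dist, NNReal.dist_eq, dist_eq_norm,
    ENNReal.ofReal_eq_ofReal_iff (abs_nonneg _) (norm_nonneg _)] at h
  have h2 : (‖x‖ - ‖y‖) ^ 2 = ‖x - y‖ ^ 2 := by rw [← h, sq_abs]; rfl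
  rw [norm_sub_sq_real] at h2
  have h3 : inner ℝ x y = ‖x‖ * ‖y‖ := by linarith
  rw [inner_eq_norm_mul_iff_real] at h3
  rw [div_eq_inv_mul, mul_smul, h3, inv_smul_smul₀ hx']

end SecondMoment

/-! ### Transport between radially contoured distributions -/

section RadiallyContoured

variable {d : ℕ} {μ μ₀ μ₁ : Measure (EuclideanSpace ℝ (Fin d))}
  {m m₀ m₁ : EuclideanSpace ℝ (Fin d)} {ρ ρ₀ ρ₁ : ℝ≥0 → ℝ≥0} {C : ℝ≥0 → ℝ≥0∞}

theorem withDensity_eq_radialExtension_radialMeasure (hd : 1 ≤ d)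
    (m : EuclideanSpace ℝ (Fin d)) (hρ : Measurable ρ) :
    (volume : Measure (EuclideanSpace ℝ (Fin d))).withDensity (fun x => (ρ ‖x - m‖₊ : ℝ≥0∞)) =
      radialExtension (volume : Measure (EuclideanSpace ℝ (Fin d))).toSphere m
        (radialMeasure d ρ) := by
  have : Nonempty (Fin d) := ⟨⟨0, hd⟩⟩
  rw [withDensity_radial_eq_radialExtension _ m hρ, finrank_euclideanSpace_fin]

namespace IsRadiallyContoured

theorem eq_radialExtension (hμ : IsRadiallyContoured μ m ρ) (hd : 1 ≤ d) :
    μ = radialExtension (volume : Measure (EuclideanSpace ℝ (Fin d))).toSphere m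
      (radialMeasure d ρ) := by
  rw [← withDensity_eq_radialExtension_radialMeasure hd m hμ.measurable_generator,
    ← hμ.eq_withDensity]

theorem map_nnnorm_sub (hμ : IsRadiallyContoured μ m ρ) (hd : 1 ≤ d) :
    μ.map (fun x => ‖x - m‖₊) = ENNReal.ofReal (sphereArea d) • radialMeasure d ρ := by
  rw [hμ.eq_radialExtension hd, map_nnnorm_sub_radialExtension, toSphere_volume_univ hd]

theorem radialMeasure_univ (hμ : IsRadiallyContoured μ m ρ) (hd : 1 ≤ d) :
    radialMeasure d ρ univ = (ENNReal.ofReal (sphereArea d))⁻¹ := by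
  have := hμ.isProbabilityMeasure
  have h := congrArg (fun κ => κ univ) (hμ.map_nnnorm_sub hd)
  simp only [Measure.map_apply (by fun_prop : Measurable fun x => ‖x - m‖₊) .univ, preimage_univ,
    measure_univ, Measure.smul_apply, smul_eq_mul] at h
  rw [mul_comm] at h
  exact ENNReal.eq_inv_of_mul_eq_one_left h.symm

theorem isFiniteMeasure_radialMeasure (hμ : IsRadiallyContoured μ m ρ) (hd : 1 ≤ d) :
    IsFiniteMeasure (radialMeasure d ρ) := by
  constructor
  rw [hμ.radialMeasure_univ hd]
  simpa using sphereArea_pos hd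

theorem memLp_id (hμ : IsRadiallyContoured μ m ρ) : MemLp (fun x => x) 2 μ :=
  (memLp_two_iff_lintegral_enorm_sq (by fun_prop)).2 hμ.secondMoment_lt_top

theorem memLp_sub (hμ : IsRadiallyContoured μ m ρ) : MemLp (fun x => x - m) 2 μ :=
  have := hμ.isProbabilityMeasure
  hμ.memLp_id.sub (memLp_const m)

theorem integral_sub_eq_zero (hμ : IsRadiallyContoured μ m ρ) : ∫ x, (x - m) ∂μ = 0 := by
  rw [hμ.eq_withDensity]
  exact integral_sub_center_eq_zero _ m hμ.measurable_generator

theorem lintegral_sq_radialMeasure_ne_top (hμ : IsRadiallyContoured μ m ρ) (hd : 1 ≤ d) :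
    ∫⁻ r, (r : ℝ≥0∞) ^ 2 ∂(radialMeasure d ρ) ≠ ∞ := by
  have h := (memLp_two_iff_lintegral_enorm_sq (by fun_prop)).1 hμ.memLp_sub
  have e : ∫⁻ x, ‖x - m‖ₑ ^ 2 ∂μ =
      ENNReal.ofReal (sphereArea d) * ∫⁻ r, (r : ℝ≥0∞) ^ 2 ∂(radialMeasure d ρ) := by
    rw [← smul_eq_mul, ← lintegral_smul_measure, ← hμ.map_nnnorm_sub hd,
      lintegral_map (by fun_prop) (by fun_prop)]
    rfl
  rw [e] at h
  intro htop
  rw [htop, ENNReal.mul_top (by simpa using sphereArea_pos hd)] at h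
  exact lt_irrefl _ h

theorem ae_radius (hμ : IsRadiallyContoured μ m ρ) (hd : 1 ≤ d) {P : ℝ≥0 → Prop}
    (h : ∀ᵐ r ∂(radialMeasure d ρ), P r) : ∀ᵐ x ∂μ, P ‖x - m‖₊ := by
  refine ae_of_ae_map (f := fun x => ‖x - m‖₊) (by fun_prop) ?_
  rw [hμ.map_nnnorm_sub hd]
  exact Measure.ae_smul_measure h _

theorem ae_ne_center (hμ : IsRadiallyContoured μ m ρ) (hd : 1 ≤ d) : ∀ᵐ x ∂μ, x ≠ m := by
  have h0 : ∀ᵐ r ∂(radialMeasure d ρ), r ≠ 0 := by simp [ae_iff]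
  filter_upwards [hμ.ae_radius hd h0] with x hx
  simpa [sub_eq_zero] using hx

/-- A radial map sends a radially contoured distribution to the one with the image radial law. -/
theorem map_radial (hμ : IsRadiallyContoured μ m ρ) (hd : 1 ≤ d) {g : ℝ≥0 → ℝ≥0}
    (hg : Measurable g) {ρ' : ℝ≥0 → ℝ≥0} (hρ' : Measurable ρ')
    (h : (radialMeasure d ρ).map g = radialMeasure d ρ') (m' : EuclideanSpace ℝ (Fin d)) :
    μ.map (fun x => ((g ‖x - m‖₊ : ℝ) / ‖x - m‖) • (x - m) + m') =
      (volume : Measure (EuclideanSpace ℝ (Fin d))).withDensity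
        (fun x => (ρ' ‖x - m'‖₊ : ℝ≥0∞)) := by
  rw [withDensity_eq_radialExtension_radialMeasure hd m' hρ', ← h, ← map_radial_radialExtension,
    ← hμ.eq_radialExtension hd]
  exact hg

end IsRadiallyContoured

theorem measurable_radialTransport (m₀ m₁ : EuclideanSpace ℝ (Fin d)) (hC : Measurable C) :
    Measurable (radialTransport m₀ m₁ C) := by
  have : Measurable fun x : EuclideanSpace ℝ (Fin d) => (C ‖x - m₀‖₊).toReal :=
    (hC.comp (by fun_prop)).ennreal_toReal
  unfold radialTransport
  fun_prop

theorem map_radialTransport (hd : 1 ≤ d) (hμ₀ : IsRadiallyContoured μ₀ m₀ ρ₀)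
    (hμ₁ : IsRadiallyContoured μ₁ m₁ ρ₁) (hmeas : Measurable C)
    (h : (radialMeasure d ρ₀).map (fun r => (C r).toNNReal) = radialMeasure d ρ₁) :
    μ₀.map (radialTransport m₀ m₁ C) = μ₁ :=
  (hμ₀.map_radial hd hmeas.ennreal_toNNReal hμ₁.measurable_generator h m₁).trans
    hμ₁.eq_withDensity.symm

/-- The identity of maps holds at every point: at `m₀` both sides drop the radial term, and `toReal`
reads an infinite `C` as 0 on both sides. -/
theorem mccannInterpolation_radialTransport {t : ℝ} (ht : t ∈ Icc (0 : ℝ) 1) :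
    mccannInterpolation μ₀ (radialTransport m₀ m₁ C) t =
      μ₀.map fun x => ((radialInterp C t ‖x - m₀‖₊ : ℝ) / ‖x - m₀‖) • (x - m₀) +
        ((1 - t) • m₀ + t • m₁) := by
  unfold mccannInterpolation
  congr 1
  ext1 x
  rw [coe_radialInterp ht, radialTransport]
  rcases eq_or_ne x m₀ with rfl | hx
  · simp
  · have hx' : ‖x - m₀‖ ≠ 0 := norm_ne_zero_iff.2 (sub_ne_zero.2 hx)
    rw [coe_nnnorm, add_div, mul_div_assoc, mul_div_assoc, div_self hx', mul_one, add_smul,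
      mul_smul, smul_add, smul_sub (1 - t)]
    abel

theorem isRadiallyContoured_mccannInterpolation (hd : 1 ≤ d)
    (hμ₀ : IsRadiallyContoured μ₀ m₀ ρ₀) (hμ₁ : IsRadiallyContoured μ₁ m₁ ρ₁) (hmeas : Measurable C)
    (h : (radialMeasure d ρ₀).map (fun r => (C r).toNNReal) = radialMeasure d ρ₁)
    {t : ℝ} (ht : t ∈ Icc (0 : ℝ) 1) {ρt : ℝ≥0 → ℝ≥0} (hρt : Measurable ρt)
    (hmap : (radialMeasure d ρ₀).map (radialInterp C t) = radialMeasure d ρt) :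
    IsRadiallyContoured (mccannInterpolation μ₀ (radialTransport m₀ m₁ C) t)
      ((1 - t) • m₀ + t • m₁) ρt := by
  have hT := measurable_radialTransport m₀ m₁ hmeas
  have hTt : Measurable fun x => (1 - t) • x + t • radialTransport m₀ m₁ C x := by fun_prop
  have := hμ₀.isProbabilityMeasure
  refine ⟨hρt, Measure.isProbabilityMeasure_map hTt.aemeasurable, ?_, ?_⟩
  · rw [mccannInterpolation_radialTransport ht,
      hμ₀.map_radial hd (measurable_radialInterp hmeas t) hρt hmap]
  · rw [mccannInterpolation, lintegral_map (by fun_prop) hTt]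
    have hL : MemLp (radialTransport m₀ m₁ C) 2 μ₀ :=
      hμ₁.memLp_id.comp_measurePreserving ⟨hT, map_radialTransport hd hμ₀ hμ₁ hmeas h⟩
    exact (memLp_two_iff_lintegral_enorm_sq hTt.aestronglyMeasurable).1
      ((hμ₀.memLp_id.const_smul (1 - t)).add (hL.const_smul t))

theorem couplings_map {X Y : Type*} [MeasurableSpace X] [MeasurableSpace Y] {μ ν : Measure X}
    {f g : X → Y} (hf : Measurable f) (hg : Measurable g) {γ : Measure (X × X)}
    (hγ : γ ∈ couplings μ ν) : γ.map (Prod.map f g) ∈ couplings (μ.map f) (ν.map g) := by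
  constructor
  · rw [Measure.map_map measurable_fst (hf.prodMap hg), ← hγ.1, Measure.map_map hf measurable_fst]
    rfl
  · rw [Measure.map_map measurable_snd (hf.prodMap hg), ← hγ.2, Measure.map_map hg measurable_snd]
    rfl

/-- The cost of a coupling of radially contoured distributions dominates that of the radial
rearrangement `G`; equality forces the coupling to be carried by the graph of the radial map. -/
theorem lintegral_edist_sq_coupling_ge (hd : 1 ≤ d)
    (hμ₀ : IsRadiallyContoured μ₀ m₀ ρ₀) (hμ₁ : IsRadiallyContoured μ₁ m₁ ρ₁) {G : ℝ≥0 → ℝ≥0}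
    (hG : Measurable G) {E : Set ℝ≥0} (hE : ∀ᵐ r ∂(radialMeasure d ρ₀), r ∈ E)
    (hmono : MonotoneOn G E) (h : (radialMeasure d ρ₀).map G = radialMeasure d ρ₁)
    {γ : Measure (EuclideanSpace ℝ (Fin d) × EuclideanSpace ℝ (Fin d))}
    (hγ : γ ∈ couplings μ₀ μ₁) :
    ENNReal.ofReal (‖m₀ - m₁‖ ^ 2) + ENNReal.ofReal (sphereArea d) *
        ∫⁻ r, edist r (G r) ^ 2 ∂(radialMeasure d ρ₀) ≤ ∫⁻ p, edist p.1 p.2 ^ 2 ∂γ ∧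
      (∫⁻ p, edist p.1 p.2 ^ 2 ∂γ ≤ ENNReal.ofReal (‖m₀ - m₁‖ ^ 2) +
          ENNReal.ofReal (sphereArea d) * ∫⁻ r, edist r (G r) ^ 2 ∂(radialMeasure d ρ₀) →
        ∀ᵐ p ∂γ, p.2 = ((G ‖p.1 - m₀‖₊ : ℝ) / ‖p.1 - m₀‖) • (p.1 - m₀) + m₁) := by
  have := hμ₀.isProbabilityMeasure
  have := hμ₀.isFiniteMeasure_radialMeasure hd
  set A := ENNReal.ofReal (sphereArea d) with hA
  have hAtop : A ≠ ∞ := ENNReal.ofReal_ne_top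
  have : IsFiniteMeasure (A • radialMeasure d ρ₀) := by
    rw [← hμ₀.map_nnnorm_sub hd]; infer_instance
  have hmeas : Measurable (Prod.map (fun x : EuclideanSpace ℝ (Fin d) => ‖x - m₀‖₊)
      fun y : EuclideanSpace ℝ (Fin d) => ‖y - m₁‖₊) := by fun_prop
  have hγ' := couplings_map (f := fun x => ‖x - m₀‖₊) (g := fun x => ‖x - m₁‖₊)
    (by fun_prop) (by fun_prop) hγ
  rw [hμ₀.map_nnnorm_sub hd, hμ₁.map_nnnorm_sub hd, ← h, ← Measure.map_smul] at hγ'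
  obtain ⟨hle, heq⟩ := lintegral_edist_sq_le_of_monotoneOn hG (Measure.ae_smul_measure hE A) hmono
    hγ' (by
      rw [lintegral_smul_measure]
      exact ENNReal.mul_ne_top hAtop (hμ₀.lintegral_sq_radialMeasure_ne_top hd)) (by
      rw [Measure.map_smul, h, lintegral_smul_measure]
      exact ENNReal.mul_ne_top hAtop (hμ₁.lintegral_sq_radialMeasure_ne_top hd))
  rw [lintegral_smul_measure, smul_eq_mul, lintegral_map (by fun_prop) hmeas] at hle heq
  simp only [Prod.map_fst, Prod.map_snd] at hle heq
  rw [lintegral_edist_sq_eq_add_centered hμ₀.memLp_sub hμ₁.memLp_sub hμ₀.integral_sub_eq_zero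
    hμ₁.integral_sub_eq_zero hγ]
  have hnorm : ∀ p : EuclideanSpace ℝ (Fin d) × EuclideanSpace ℝ (Fin d),
      edist ‖p.1 - m₀‖₊ ‖p.2 - m₁‖₊ ^ 2 ≤ edist (p.1 - m₀) (p.2 - m₁) ^ 2 := fun p =>
    pow_le_pow_left' (edist_nnnorm_le _ _) 2
  have hle2 := lintegral_mono (μ := γ) hnorm
  refine ⟨add_le_add_right (hle.trans hle2) _, fun hge => ?_⟩
  rw [ENNReal.add_le_add_iff_left ENNReal.ofReal_ne_top] at hge
  have hG' := heq (hle2.trans hge)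
  have hfin : ∫⁻ p, edist ‖p.1 - m₀‖₊ ‖p.2 - m₁‖₊ ^ 2 ∂γ ≠ ∞ := by
    have e := lintegral_edist_sq_add_of_mem_couplings hγ'
    rw [lintegral_map (by fun_prop) hmeas] at e
    refine ne_top_of_le_ne_top ?_ (le_self_add.trans e.le)
    rw [Measure.map_smul, h, lintegral_smul_measure, lintegral_smul_measure]
    exact ENNReal.add_ne_top.2
      ⟨ENNReal.mul_ne_top hAtop (hμ₀.lintegral_sq_radialMeasure_ne_top hd),
        ENNReal.mul_ne_top hAtop (hμ₁.lintegral_sq_radialMeasure_ne_top hd)⟩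
  -- The chain radial optimum ≤ cost of the radii ≤ centred cost ≤ radial optimum closes up, so the
  -- pointwise bound `hnorm` is an equality almost everywhere.
  have hae := ae_eq_of_ae_le_of_lintegral_le (ae_of_all _ hnorm) hfin (by fun_prop)
    (hge.trans hle)
  have hne : ∀ᵐ p ∂γ, p.1 ≠ m₀ :=
    ae_of_ae_map measurable_fst.aemeasurable (by rw [hγ.1]; exact hμ₀.ae_ne_center hd)
  filter_upwards [hae, ae_of_ae_map hmeas.aemeasurable hG', hne] with p h1 h2 h3
  have h4 := eq_div_norm_smul_of_edist_eq (sub_ne_zero.2 h3)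
    ((ENNReal.pow_right_strictMono two_ne_zero).injective h1)
  have h5 : ‖p.2 - m₁‖ = G ‖p.1 - m₀‖₊ := congrArg NNReal.toReal h2
  rw [h5] at h4
  rw [← h4, sub_add_cancel]

/-- After centring, a point and its image lie on one ray, so their distance is the difference of the
radii. -/
theorem lintegral_edist_radialTransport_sq (hd : 1 ≤ d)
    (hμ₀ : IsRadiallyContoured μ₀ m₀ ρ₀) (hμ₁ : IsRadiallyContoured μ₁ m₁ ρ₁) (hmeas : Measurable C)
    (h : (radialMeasure d ρ₀).map (fun r => (C r).toNNReal) = radialMeasure d ρ₁) :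
    ∫⁻ x, edist x (radialTransport m₀ m₁ C x) ^ 2 ∂μ₀ =
      ENNReal.ofReal (‖m₀ - m₁‖ ^ 2) + ENNReal.ofReal (sphereArea d) *
        ∫⁻ r, edist r (C r).toNNReal ^ 2 ∂(radialMeasure d ρ₀) := by
  have := hμ₀.isProbabilityMeasure
  have hT := measurable_radialTransport m₀ m₁ hmeas
  have hγ := map_graph_mem_couplings μ₀ hT
  rw [map_radialTransport hd hμ₀ hμ₁ hmeas h] at hγ
  have e := lintegral_edist_sq_eq_add_centered hμ₀.memLp_sub hμ₁.memLp_sub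
    hμ₀.integral_sub_eq_zero hμ₁.integral_sub_eq_zero hγ
  rw [lintegral_map (by fun_prop) (by fun_prop), lintegral_map (by fun_prop) (by fun_prop)] at e
  have hG : Measurable fun r => (C r).toNNReal := hmeas.ennreal_toNNReal
  rw [e, ← smul_eq_mul, ← lintegral_smul_measure, ← hμ₀.map_nnnorm_sub hd,
    lintegral_map (by fun_prop) (by fun_prop)]
  congr 1
  refine lintegral_congr_ae ?_
  filter_upwards [hμ₀.ae_ne_center hd] with x hx
  rw [← edist_div_norm_smul (sub_ne_zero.2 hx), radialTransport, add_sub_cancel_right]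
  rfl

end RadiallyContoured

/-! ### The cost as a real integral, and the theorem -/

theorem integrable_and_ofReal_integral_radial_cost {d : ℕ} {ρ₀ : ℝ≥0 → ℝ≥0}
    (hρ₀ : Measurable ρ₀) {C : ℝ≥0 → ℝ≥0∞} (hmeas : Measurable C)
    (hfin : ∫⁻ r, edist r (C r).toNNReal ^ 2 ∂(radialMeasure d ρ₀) ≠ ∞) :
    Integrable (fun r : ℝ≥0 =>
        ((C r).toReal - (r : ℝ)) ^ 2 * (ρ₀ r : ℝ) * (r : ℝ) ^ (d - 1)) halfLineVolume ∧
      ENNReal.ofReal (∫ r : ℝ≥0, ((C r).toReal - (r : ℝ)) ^ 2 * (ρ₀ r : ℝ) * (r : ℝ) ^ (d - 1)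
          ∂halfLineVolume) = ∫⁻ r, edist r (C r).toNNReal ^ 2 ∂(radialMeasure d ρ₀) := by
  have hC : Measurable fun r => (C r).toReal := hmeas.ennreal_toReal
  have hC' : Measurable fun r => (C r).toNNReal := hmeas.ennreal_toNNReal
  have hnn : ∀ r : ℝ≥0, 0 ≤ ((C r).toReal - (r : ℝ)) ^ 2 * (ρ₀ r : ℝ) * (r : ℝ) ^ (d - 1) :=
    fun r => by positivity
  have hF : Measurable fun r : ℝ≥0 =>
      ((C r).toReal - (r : ℝ)) ^ 2 * (ρ₀ r : ℝ) * (r : ℝ) ^ (d - 1) := by fun_prop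
  have e : ∫⁻ r, edist r (C r).toNNReal ^ 2 ∂(radialMeasure d ρ₀) = ∫⁻ r : ℝ≥0, ENNReal.ofReal
      (((C r).toReal - (r : ℝ)) ^ 2 * (ρ₀ r : ℝ) * (r : ℝ) ^ (d - 1)) ∂halfLineVolume := by
    rw [radialMeasure, lintegral_withDensity_eq_lintegral_mul _ (by fun_prop) (by fun_prop)]
    refine lintegral_congr fun r => ?_
    rw [Pi.mul_apply, edist_nndist, ← ENNReal.coe_pow, ← ENNReal.coe_mul,
      ← ENNReal.ofReal_coe_nnreal]
    congr 1
    push_cast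
    rw [NNReal.dist_eq, sq_abs]
    simp only [ENNReal.coe_toNNReal_eq_toReal]
    ring
  have hI : Integrable (fun r : ℝ≥0 =>
      ((C r).toReal - (r : ℝ)) ^ 2 * (ρ₀ r : ℝ) * (r : ℝ) ^ (d - 1)) halfLineVolume := by
    refine ⟨hF.aestronglyMeasurable, ?_⟩
    rw [hasFiniteIntegral_iff_ofReal (ae_of_all _ hnn), ← e]
    exact hfin.lt_top
  exact ⟨hI, by rw [e, ofReal_integral_eq_lintegral_ofReal hI (ae_of_all _ hnn)]⟩

theorem theorem3p1 (d : ℕ) (hd : 1 ≤ d)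
    (μ₀ μ₁ : Measure (EuclideanSpace ℝ (Fin d))) (m₀ m₁ : EuclideanSpace ℝ (Fin d))
    (ρ₀ ρ₁ : ℝ≥0 → ℝ≥0) (hρ₀ : Continuous ρ₀) (hρ₁ : Continuous ρ₁)
    (hμ₀ : IsRadiallyContoured μ₀ m₀ ρ₀) (hμ₁ : IsRadiallyContoured μ₁ m₁ ρ₁) :
    (∃ C : ℝ≥0 → ℝ≥0∞, Monotone C ∧ MatchesRadialMass d ρ₀ ρ₁ C) ∧
    ∀ C : ℝ≥0 → ℝ≥0∞, Measurable C → MatchesRadialMass d ρ₀ ρ₁ C →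
      -- the formula for `T` makes sense almost everywhere
      (∀ᵐ x ∂μ₀, x ≠ m₀ ∧ C ‖x - m₀‖₊ ≠ ∞) ∧
      -- `T` is the Monge map, unique up to null sets
      IsMongeMap μ₀ μ₁ (radialTransport m₀ m₁ C) ∧
      (∀ S, IsMongeMap μ₀ μ₁ S → S =ᵐ[μ₀] radialTransport m₀ m₁ C) ∧
      -- the McCann interpolation
      (∀ t ∈ Icc (0 : ℝ) 1,
        (∃ ρt : ℝ≥0 → ℝ≥0, Measurable ρt ∧
          (radialMeasure d ρ₀).map (radialInterp C t) = radialMeasure d ρt) ∧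
        ∀ ρt : ℝ≥0 → ℝ≥0, Measurable ρt →
          (radialMeasure d ρ₀).map (radialInterp C t) = radialMeasure d ρt →
          IsRadiallyContoured (mccannInterpolation μ₀ (radialTransport m₀ m₁ C) t)
            ((1 - t) • m₀ + t • m₁) ρt) ∧
      -- the Wasserstein distance
      wassersteinTwo μ₀ μ₁ ^ 2 = ENNReal.ofReal (‖m₀ - m₁‖ ^ 2) +
        ENNReal.ofReal (sphereArea d) *
          wassersteinTwo (radialMeasure d ρ₀) (radialMeasure d ρ₁) ^ 2 ∧
      Integrable (fun r : ℝ≥0 =>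
        ((C r).toReal - (r : ℝ)) ^ 2 * (ρ₀ r : ℝ) * (r : ℝ) ^ (d - 1)) halfLineVolume ∧
      wassersteinTwo μ₀ μ₁ ^ 2 = ENNReal.ofReal (‖m₀ - m₁‖ ^ 2 + sphereArea d *
        ∫ r : ℝ≥0, ((C r).toReal - (r : ℝ)) ^ 2 * (ρ₀ r : ℝ) * (r : ℝ) ^ (d - 1)
          ∂halfLineVolume) := by
  have := hμ₀.isFiniteMeasure_radialMeasure hd
  have := hμ₁.isFiniteMeasure_radialMeasure hd
  have hmass : radialMeasure d ρ₀ univ = radialMeasure d ρ₁ univ := by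
    rw [hμ₀.radialMeasure_univ hd, hμ₁.radialMeasure_univ hd]
  refine ⟨?_, fun C hmeas hC => ?_⟩
  · obtain ⟨C, hCmono, hC⟩ := exists_monotone_measure_matching _ _ hmass
    exact ⟨C, hCmono, matchesRadialMass_iff.2 hC⟩
  have hC' := matchesRadialMass_iff.1 hC
  have hG : Measurable fun r => (C r).toNNReal := hmeas.ennreal_toNNReal
  have hmap := map_toNNReal_of_measure_matching hmass hC' hmeas
  obtain ⟨E, hE, hmono⟩ := exists_monotoneOn_of_measure_matching hmass hC'
  have hT := measurable_radialTransport m₀ m₁ hmeas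
  have hTmap := map_radialTransport hd hμ₀ hμ₁ hmeas hmap
  have hcost := lintegral_edist_radialTransport_sq hd hμ₀ hμ₁ hmeas hmap
  have hopt := fun γ (hγ : γ ∈ couplings μ₀ μ₁) =>
    lintegral_edist_sq_coupling_ge hd hμ₀ hμ₁ hG hE hmono hmap hγ
  have hgraph : ∀ S, Measurable S → μ₀.map S = μ₁ →
      (μ₀.map fun x => (x, S x)) ∈ couplings μ₀ μ₁ := fun S hS hSmap => by
    simpa only [hSmap] using map_graph_mem_couplings μ₀ hS
  have hgraph_cost : ∀ S, Measurable S → ∫⁻ p, edist p.1 p.2 ^ 2 ∂(μ₀.map fun x => (x, S x)) =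
      ∫⁻ x, edist x (S x) ^ 2 ∂μ₀ := fun S hS => by
    rw [lintegral_map (by fun_prop) (by fun_prop)]
  have hmonge : IsMongeMap μ₀ μ₁ (radialTransport m₀ m₁ C) := by
    refine ⟨hT, hTmap, fun S hS hSmap => ?_⟩
    rw [hcost, ← hgraph_cost S hS]
    exact (hopt _ (hgraph S hS hSmap)).1
  have h₀ := hμ₀.lintegral_sq_radialMeasure_ne_top hd
  have h₁ := hμ₁.lintegral_sq_radialMeasure_ne_top hd
  have hW : wassersteinTwo μ₀ μ₁ ^ 2 = ENNReal.ofReal (‖m₀ - m₁‖ ^ 2) +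
      ENNReal.ofReal (sphereArea d) *
        ∫⁻ r, edist r (C r).toNNReal ^ 2 ∂(radialMeasure d ρ₀) := by
    rw [wassersteinTwo_sq_eq (hgraph _ hT hTmap), hgraph_cost _ hT, hcost]
    intro γ hγ
    rw [hgraph_cost _ hT, hcost]
    exact (hopt γ hγ).1
  have hcoupling := map_graph_mem_couplings (radialMeasure d ρ₀) hG
  have hWrad : wassersteinTwo (radialMeasure d ρ₀) (radialMeasure d ρ₁) ^ 2 =
      ∫⁻ r, edist r (C r).toNNReal ^ 2 ∂(radialMeasure d ρ₀) := by
    have e : ∫⁻ p, edist p.1 p.2 ^ 2 ∂((radialMeasure d ρ₀).map fun r => (r, (C r).toNNReal)) =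
        ∫⁻ r, edist r (C r).toNNReal ^ 2 ∂(radialMeasure d ρ₀) := by
      rw [lintegral_map (by fun_prop) (by fun_prop)]
    rw [← e, ← hmap]
    refine wassersteinTwo_sq_eq hcoupling fun γ hγ => ?_
    rw [e]
    exact (lintegral_edist_sq_le_of_monotoneOn hG hE hmono hγ h₀ (by rwa [hmap])).1
  have hfin : ∫⁻ r, edist r (C r).toNNReal ^ 2 ∂(radialMeasure d ρ₀) ≠ ∞ := by
    have e := lintegral_edist_sq_add_of_mem_couplings hcoupling
    rw [lintegral_map (by fun_prop) (by fun_prop), hmap] at e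
    exact ne_top_of_le_ne_top (ENNReal.add_ne_top.2 ⟨h₀, h₁⟩) (le_self_add.trans e.le)
  obtain ⟨hint, hval⟩ :=
    integrable_and_ofReal_integral_radial_cost hμ₀.measurable_generator hmeas hfin
  refine ⟨?_, hmonge, fun S hS => ?_, fun t ht => ⟨?_, fun ρt hρt hρtmap => ?_⟩, ?_, hint, ?_⟩
  · exact (hμ₀.ae_ne_center hd).and (hμ₀.ae_radius hd (ae_ne_top_of_measure_matching hmass hC'))
  -- Comparison with T puts the graph coupling of `S` in the equality case of the lower bound, so it
  -- is carried by the graph of T.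
  · have hle := hS.optimal _ hT hTmap
    rw [hcost, ← hgraph_cost S hS.measurable] at hle
    have hae := (hopt _ (hgraph S hS.measurable hS.map_eq)).2 hle
    exact ae_of_ae_map (measurable_id.prodMk hS.measurable).aemeasurable hae
  · exact exists_map_radialInterp_eq hμ₁.measurable_generator hmass hmeas hC ht
  · exact isRadiallyContoured_mccannInterpolation hd hμ₀ hμ₁ hmeas hmap ht hρt hρtmap
  · rw [hW, hWrad]
  · rw [hW, ENNReal.ofReal_add (by positivity)
      (mul_nonneg (sphereArea_pos hd).le (integral_nonneg fun r => by positivity)),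
      ENNReal.ofReal_mul (sphereArea_pos hd).le, hval]
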